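/- Let $\Bbbk$ be an algebraically closed field. For a finite quiver $Q$, paths are composed from left to right ($pq$ is defined when $p$ ends where $q$ starts). A pair $(Q,I)$, with $I$ a two-sided ideal of the path algebra $\Bbbk Q$, is a *string quiver* if every vertex is the starting point of at most two arrows and the ending point of at most two arrows; for each arrow $\alpha$ there is at most one arrow $\beta$ with $\alpha\beta$ a path not in $I$ and at most one arrow $\beta$ with $\beta\alpha$ a path not in $I$; and $I$ is admissible and generated by paths of length $\ge 2$. A *string algebra* is a finite-dimensional $\Bbbk$-algebra $A$ isomorphic to $\Bbbk Q/I$ for a string quiver $(Q,I)$. Modules are finitely generated right $A$-modules. A module $G$ is *Gorenstein-projective* if there is an exact complex $\cdots\to P^{-1}\xrightarrow{d^{-1}}P^0\xrightarrow{d^0}P^1\to\cdots$ of finitely generated projective modules that remains exact under $\mathrm{Hom}_A(-,A)$ and satisfies $G\cong\operatorname{Im}d^{-1}$. The algebra $A$ is *CM-finite* if it has only finitely many indecomposable Gorenstein-projective modules up to isomorphism, and *CM-free* if the Gorenstein-projective modules are exactly the projective ones. A *perfect pair* on $(Q,I)$ is a pair $(p,q)$ of nontrivial paths $p,q\notin I$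 such that $p$ ends where $q$ starts, $pq\in I$, every nontrivial path $q'\notin I$ starting where $p$ ends with $pq'\in I$ is of the form $q'=qr$ for some path $r$, and every nontrivial path $p'\notin I$ ending where $q$ starts with $p'q\in I$ is of the form $p'=rp$ for some path $r$. A *perfect path sequence* is a sequence of paths $(p_1,p_2,\dots,p_t)$ with $t\ge 2$ and $p_t=p_1$ such that $(p_i,p_{i+1})$ is a perfect pair for all $1\le i<t$. Let $A\cong\Bbbk Q/I$ be a string algebra, with $(Q,I)$ a string quiver. Then: 1. $A$ is CM-finite. 2. $A$ is CM-free if and only if there is no perfect path sequence on $(Q,I)$. -/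

import Mathlib

universe u v w

namespace StringAlg

/-! ### Path algebras -/

/-- The paths of a quiver, bundled with their starting point and ending point. Paths are composed
from left to right: `p.comp q` is the path `pq`, where `p` ends at the starting point of `q`. -/
abbrev AnyPath (V : Type v) [Quiver.{w} V] : Type (max v w) :=
  Σ a b : V, Quiver.Path a b

/-- The path algebra `kQ`: the vector space with basis the set of all paths of the quiver. -/
def PathAlgebra (k : Type u) (V : Type v) [Field k] [Quiver.{w} V] : Type (max u v w) :=
  AnyPath V →₀ k

namespace PathAlgebra

variable {k : Type u} {V : Type v} [Field k] [Quiver.{w} V]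

noncomputable instance : AddCommGroup (PathAlgebra k V) :=
  inferInstanceAs (AddCommGroup (AnyPath V →₀ k))

noncomputable instance : Module k (PathAlgebra k V) :=
  inferInstanceAs (Module k (AnyPath V →₀ k))

variable (k) in
/-- The element of the path algebra given by a bundled path. -/
noncomputable def single (p : AnyPath V) : PathAlgebra k V := Finsupp.single p (1 : k)

variable (k) in
/-- The element of the path algebra given by a path. -/
noncomputable def ofPath {a b : V} (p : Quiver.Path a b) : PathAlgebra k V := single k ⟨a, b, p⟩

open Classical in
variable (k) in
/-- The product of two paths: their concatenation if it is defined, and `0` otherwise. -/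
noncomputable def pathMul (p q : AnyPath V) : PathAlgebra k V :=
  if h : p.2.1 = q.1 then ofPath k (p.2.2.comp (q.2.2.cast h.symm rfl)) else 0

variable (k V) in
/-- The bilinear extension of the product of paths. -/
noncomputable def mulLin : PathAlgebra k V →ₗ[k] PathAlgebra k V →ₗ[k] PathAlgebra k V :=
  Finsupp.linearCombination k fun p : AnyPath V =>
    (Finsupp.linearCombination k (fun q : AnyPath V => pathMul k p q) :
      (AnyPath V →₀ k) →ₗ[k] PathAlgebra k V)

noncomputable instance : Mul (PathAlgebra k V) := ⟨fun x y => mulLin k V x y⟩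

theorem mul_def (x y : PathAlgebra k V) : x * y = mulLin k V x y := rfl

theorem mulLin_single_single (p q : AnyPath V) :
    mulLin k V (single k p) (single k q) = pathMul k p q := by
  have h₁ : mulLin k V (single k p) = (Finsupp.linearCombination k
      (fun q : AnyPath V => pathMul k p q) : (AnyPath V →₀ k) →ₗ[k] PathAlgebra k V) :=
    (Finsupp.linearCombination_single k 1 p).trans (one_smul k _)
  rw [h₁]
  exact (Finsupp.linearCombination_single k 1 q).trans (one_smul k _)

theorem single_mul_single (p q : AnyPath V) : single k p * single k q = pathMul k p q :=
  mulLin_single_single p q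

theorem ofPath_mul_ofPath {a b c : V} (p : Quiver.Path a b) (q : Quiver.Path b c) :
    ofPath k p * ofPath k q = ofPath k (p.comp q) := by
  simp [ofPath, single_mul_single, pathMul]

theorem ofPath_mul_ofPath_of_ne {a b b' c : V} (p : Quiver.Path a b) (q : Quiver.Path b' c)
    (h : b ≠ b') : ofPath k p * ofPath k q = 0 := by
  simp [ofPath, single_mul_single, pathMul, h]

theorem span_single : Submodule.span k (Set.range (single k : AnyPath V → PathAlgebra k V)) = ⊤ := by
  rw [eq_top_iff]
  intro x _
  have := Finsupp.induction_linear (motive := fun x : AnyPath V →₀ k =>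
    (x : PathAlgebra k V) ∈ Submodule.span k (Set.range (single k : AnyPath V → PathAlgebra k V)))
    x (Submodule.zero_mem _) (fun _ _ h h' => Submodule.add_mem _ h h') ?_
  · exact this
  · intro p r
    have h : (Finsupp.single p r : AnyPath V →₀ k) = (r • Finsupp.single p (1 : k)) := by simp
    rw [h]
    exact Submodule.smul_mem (M := PathAlgebra k V) _ r (Submodule.subset_span ⟨p, rfl⟩)

/-- An induction principle: an additive and homogeneous property of paths holds everywhere. -/
theorem induction {motive : PathAlgebra k V → Prop} (x : PathAlgebra k V)
    (path : ∀ {a b : V} (p : Quiver.Path a b), motive (ofPath k p)) (zero : motive 0)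
    (add : ∀ x y, motive x → motive y → motive (x + y))
    (smul : ∀ (r : k) x, motive x → motive (r • x)) : motive x := by
  have hx : x ∈ Submodule.span k (Set.range (single k : AnyPath V → PathAlgebra k V)) := by
    rw [span_single]; trivial
  induction hx using Submodule.span_induction with
  | mem x h => obtain ⟨⟨a, b, p⟩, rfl⟩ := h; exact path p
  | zero => exact zero
  | add x y _ _ hx hy => exact add x y hx hy
  | smul r x _ hx => exact smul r x hx

private theorem add_mul' (x y z : PathAlgebra k V) : (x + y) * z = x * z + y * z := by
  simp [mul_def]

private theorem mul_add' (x y z : PathAlgebra k V) : x * (y + z) = x * y + x * z := by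
  simp [mul_def]

private theorem smul_mul' (r : k) (x y : PathAlgebra k V) : (r • x) * y = r • (x * y) := by
  simp [mul_def]

private theorem mul_smul' (r : k) (x y : PathAlgebra k V) : x * (r • y) = r • (x * y) := by
  simp [mul_def]

private theorem zero_mul' (x : PathAlgebra k V) : 0 * x = 0 := by simp [mul_def]

private theorem mul_zero' (x : PathAlgebra k V) : x * 0 = 0 := by simp [mul_def]

private theorem mul_assoc' (x y z : PathAlgebra k V) : x * y * z = x * (y * z) := by
  induction x using induction with
  | zero => simp only [zero_mul']
  | add x x' h h' => simp only [add_mul', h, h']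
  | smul r x h => simp only [smul_mul', h]
  | @path a b p =>
  induction y using induction with
  | zero => simp only [zero_mul', mul_zero']
  | add x x' h h' => simp only [add_mul', mul_add', h, h']
  | smul r x h => simp only [smul_mul', mul_smul', h]
  | @path c d q =>
  induction z using induction with
  | zero => simp only [mul_zero']
  | add x x' h h' => simp only [mul_add', h, h']
  | smul r x h => simp only [mul_smul', h]
  | @path e f s =>
  by_cases h₁ : b = c
  · subst h₁
    by_cases h₂ : d = e
    · subst h₂
      simp only [ofPath_mul_ofPath, Quiver.Path.comp_assoc]
    · rw [ofPath_mul_ofPath, ofPath_mul_ofPath_of_ne _ _ h₂, ofPath_mul_ofPath_of_ne _ _ h₂,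
        mul_zero']
  · rw [ofPath_mul_ofPath_of_ne _ _ h₁, zero_mul']
    by_cases h₂ : d = e
    · subst h₂
      rw [ofPath_mul_ofPath, ofPath_mul_ofPath_of_ne _ _ h₁]
    · rw [ofPath_mul_ofPath_of_ne _ _ h₂, mul_zero']

/-- The unit of the path algebra of a quiver with finitely many vertices is the sum of the
trivial paths. -/
noncomputable instance [Fintype V] : One (PathAlgebra k V) :=
  ⟨∑ a : V, ofPath k (Quiver.Path.nil : Quiver.Path a a)⟩

theorem one_def [Fintype V] :
    (1 : PathAlgebra k V) = ∑ a : V, ofPath k (Quiver.Path.nil : Quiver.Path a a) := rfl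

private theorem one_mul' [Fintype V] (x : PathAlgebra k V) : 1 * x = x := by
  induction x using induction with
  | zero => simp only [mul_zero']
  | add x x' h h' => simp only [mul_add', h, h']
  | smul r x h => simp only [mul_smul', h]
  | @path a b p =>
    rw [one_def, mul_def, map_sum, LinearMap.sum_apply, Finset.sum_eq_single a]
    · rw [← mul_def, ofPath_mul_ofPath, Quiver.Path.nil_comp]
    · intro c _ hc
      rw [← mul_def, ofPath_mul_ofPath_of_ne _ _ hc]
    · simp

private theorem mul_one' [Fintype V] (x : PathAlgebra k V) : x * 1 = x := by
  induction x using induction with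
  | zero => simp only [zero_mul']
  | add x x' h h' => simp only [add_mul', h, h']
  | smul r x h => simp only [smul_mul', h]
  | @path a b p =>
    rw [one_def, mul_def, map_sum, Finset.sum_eq_single b]
    · rw [← mul_def, ofPath_mul_ofPath, Quiver.Path.comp_nil]
    · intro c _ hc
      rw [← mul_def, ofPath_mul_ofPath_of_ne _ _ (Ne.symm hc)]
    · simp

noncomputable instance [Fintype V] : Ring (PathAlgebra k V) :=
  { (inferInstance : AddCommGroup (PathAlgebra k V)) with
    mul := (· * ·)
    one := 1
    left_distrib := mul_add'
    right_distrib := add_mul'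
    zero_mul := zero_mul'
    mul_zero := mul_zero'
    mul_assoc := mul_assoc'
    one_mul := one_mul'
    mul_one := mul_one' }

noncomputable instance [Fintype V] : Algebra k (PathAlgebra k V) :=
  Algebra.ofModule smul_mul' mul_smul'

end PathAlgebra

open PathAlgebra

section BoundQuiver

variable {k : Type u} {V : Type v} [Field k] [Quiver.{w} V] [Fintype V]

variable (k V) in
/-- The arrow ideal of the path algebra: the two-sided ideal generated by all arrows. -/
noncomputable def arrowIdeal : Ideal (PathAlgebra k V) :=
  (TwoSidedIdeal.span
    {x : PathAlgebra k V | ∃ (a b : V) (α : a ⟶ b), x = ofPath k α.toPath}).asIdeal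

/-- A two-sided ideal `I` of `kQ` is admissible if `J ^ m ⊆ I ⊆ J ^ 2` for some `m ≥ 2`, where `J`
is the arrow ideal. -/
def IsAdmissible (I : Ideal (PathAlgebra k V)) : Prop :=
  ∃ m : ℕ, 2 ≤ m ∧ arrowIdeal k V ^ m ≤ I ∧ I ≤ arrowIdeal k V ^ 2

/-- The pair `(Q, I)` is a string quiver. -/
structure IsStringQuiver (I : Ideal (PathAlgebra k V)) : Prop where
  /-- every vertex is the starting point of at most two arrows -/
  card_out_le (x : V) : ENat.card (Σ y : V, x ⟶ y) ≤ 2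
  /-- every vertex is the ending point of at most two arrows -/
  card_in_le (y : V) : ENat.card (Σ x : V, x ⟶ y) ≤ 2
  /-- for each arrow `α`, there is at most one arrow `β` with `αβ ∉ I` -/
  unique_right {x y z z' : V} (α : x ⟶ y) (β : y ⟶ z) (β' : y ⟶ z')
    (h : ofPath k (α.toPath.comp β.toPath) ∉ I) (h' : ofPath k (α.toPath.comp β'.toPath) ∉ I) :
    (⟨z, β⟩ : Σ z : V, y ⟶ z) = ⟨z', β'⟩
  /-- for each arrow `α`, there is at most one arrow `β` with `βα ∉ I` -/
  unique_left {x y z z' : V} (α : x ⟶ y) (β : z ⟶ x) (β' : z' ⟶ x)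
    (h : ofPath k (β.toPath.comp α.toPath) ∉ I) (h' : ofPath k (β'.toPath.comp α.toPath) ∉ I) :
    (⟨z, β⟩ : Σ z : V, z ⟶ x) = ⟨z', β'⟩
  /-- `I` is admissible -/
  admissible : IsAdmissible I
  /-- `I` is generated, as a two-sided ideal, by paths of length at least two -/
  monomial : ∃ S : Set (AnyPath V), (∀ p ∈ S, 2 ≤ p.2.2.length) ∧
    I = (TwoSidedIdeal.span (single k '' S)).asIdeal

/-- `(p, q)` is a perfect pair of paths on `(Q, I)`. A path is zero in `kQ/I` if and only if it
belongs to `I`. -/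
def IsPerfectPair (I : Ideal (PathAlgebra k V)) {a b c : V}
    (p : Quiver.Path a b) (q : Quiver.Path b c) : Prop :=
  0 < p.length ∧ 0 < q.length ∧ ofPath k p ∉ I ∧ ofPath k q ∉ I ∧
  -- the product `pq` is zero in `kQ/I`
  ofPath k (p.comp q) ∈ I ∧
  -- every nonzero nontrivial path `q'` with `pq' = 0` starts with `q`
  (∀ (d : V) (q' : Quiver.Path b d), 0 < q'.length → ofPath k q' ∉ I →
    ofPath k (p.comp q') ∈ I → ∃ r : Quiver.Path c d, q' = q.comp r) ∧
  -- every nonzero nontrivial path `p'` with `p'q = 0` ends with `p`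
  (∀ (d : V) (p' : Quiver.Path d b), 0 < p'.length → ofPath k p' ∉ I →
    ofPath k (p'.comp q) ∈ I → ∃ r : Quiver.Path d a, p' = r.comp p)

/-- A perfect path sequence on `(Q, I)`: a sequence of paths `(s 0, s 1, …, s n)` with `n ≥ 1` and
`s n = s 0`, such that any two consecutive members form a perfect pair. -/
def IsPerfectPathSequence (I : Ideal (PathAlgebra k V)) (n : ℕ) (s : Fin (n + 1) → AnyPath V) :
    Prop :=
  1 ≤ n ∧ s (Fin.last n) = s 0 ∧
  ∀ i : Fin n, ∃ (a b c : V) (p : Quiver.Path a b) (q : Quiver.Path b c),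
    s i.castSucc = ⟨a, b, p⟩ ∧ s i.succ = ⟨b, c, q⟩ ∧ IsPerfectPair I p q

end BoundQuiver

/-! ### Gorenstein-projective modules

Right `A`-modules are modules over `Aᵐᵒᵖ`; the regular right module is `A` itself. -/

/-- `G` is a Gorenstein-projective module in the category of finitely generated right `A`-modules:
there is an exact complex `⋯ → P (-1) → P 0 → P 1 → ⋯` of finitely generated projective right
modules that stays exact under `Hom_A(-, A)`, such that `G` is isomorphic to the image of
`d (-1) : P (-1) → P 0`. -/
def IsGorensteinProjective (A : Type u) [Ring A] (G : Type u) [AddCommGroup G] [Module Aᵐᵒᵖ G] :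
    Prop :=
  ∃ (P : ℤ → Type u) (_ : ∀ i, AddCommGroup (P i)) (_ : ∀ i, Module Aᵐᵒᵖ (P i))
    (d : ∀ i, P i →ₗ[Aᵐᵒᵖ] P (i + 1)),
    (∀ i, Module.Finite Aᵐᵒᵖ (P i)) ∧ (∀ i, Module.Projective Aᵐᵒᵖ (P i)) ∧
    (∀ i, Function.Exact (d i) (d (i + 1))) ∧
    (∀ i, Function.Exact
      (fun f : P (i + 1 + 1) →ₗ[Aᵐᵒᵖ] A => f ∘ₗ d (i + 1))
      (fun f : P (i + 1) →ₗ[Aᵐᵒᵖ] A => f ∘ₗ d i)) ∧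
    Nonempty (G ≃ₗ[Aᵐᵒᵖ] LinearMap.range (d (-1)))

/-- A right module is indecomposable if it is nonzero and is not the internal direct sum of two
nonzero submodules. -/
def IsIndecomposable (A : Type u) [Ring A] (G : Type u) [AddCommGroup G] [Module Aᵐᵒᵖ G] : Prop :=
  Nontrivial G ∧ ∀ N N' : Submodule Aᵐᵒᵖ G, IsCompl N N' → N = ⊥ ∨ N' = ⊥

/-- `A` is CM-finite: up to isomorphism there are only finitely many indecomposable
Gorenstein-projective modules. -/
def IsCMFinite (A : Type u) [Ring A] : Prop :=
  ∃ (n : ℕ) (G : Fin n → ModuleCat.{u} Aᵐᵒᵖ),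
    ∀ (M : Type u) [AddCommGroup M] [Module Aᵐᵒᵖ M],
      IsGorensteinProjective A M → IsIndecomposable A M → ∃ i, Nonempty (M ≃ₗ[Aᵐᵒᵖ] G i)

/-- `A` is CM-free: the Gorenstein-projective modules are exactly the finitely generated projective
modules. -/
def IsCMFree (A : Type u) [Ring A] : Prop :=
  ∀ (M : Type u) [AddCommGroup M] [Module Aᵐᵒᵖ M],
    IsGorensteinProjective A M ↔ Module.Finite Aᵐᵒᵖ M ∧ Module.Projective Aᵐᵒᵖ M

end StringAlg

-- The nonzero paths form a `k`-basis of `A` (`pathPresentation`), and the whole argument is about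
-- coefficients in this basis. Every Gorenstein-projective module is the kernel of a map between
-- products of copies of `A`, and all its higher `Ext` groups into `A` vanish; only these two
-- consequences are used.
--
-- CM-finiteness: every indecomposable kernel `K ⊆ A^ι` is isomorphic to `pA` for a nonzero path `p`
-- (`IsString.exists_equiv_pathModule`), and there are finitely many of those. If a trivial path at
-- `v` occurs in an entry of some element of `K`, then `K` maps onto the projective `e_v A`, so it
-- is isomorphic to it. Otherwise `K` is stable under keeping only the paths with a given last
-- arrow, because maps out of `A^ι` multiply entries on the left. Choose a longest `x` with `zx ≠ 0`
-- for some `z ∈ K`; one may assume that the paths in `z` share their last arrow. For a suitable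
-- coefficient functional `φ`, the string conditions make `y ↦ ∑_{x = uv} φ(yv) zu` an endomorphism
-- of `K` that fixes `zx`. By Fitting it is surjective, while its image lies in `zA`; hence `K = zA`
-- (`IsString.range_pmul_eq`). Nonzero paths with a common last arrow are suffixes of one another,
-- so `zA ≅ pA` with `p` the shortest path in `z`.
--
-- CM-freeness: let `pA` be non-projective with vanishing `Ext` into `A`. Extending a projection
-- from the kernel of `e_b A → pA` to `e_b A` shows that this kernel is `qA` for a single path `q`
-- (`exists_syzygy_path`). The vanishing passes to `qA`, and linear forms on `qA` are left
-- multiplications, which makes the next pair of paths perfect. Iterating among finitely many paths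
-- closes a cycle. Conversely, a cycle unrolls to a totally acyclic complex of modules `e_i A` with
-- left multiplications by paths as differentials, whose image `qA` is not projective since `q =
-- qaq` is impossible for a nontrivial nonzero path.

universe u'

namespace StringAlg

open Quiver
open scoped RightActions

/-! ### Algebras with a basis of paths -/

/-- A `k`-algebra with a multiplicative family indexed by the paths of a quiver whose nonzero
members form a basis: `coef` gives the coordinates in this basis. -/
structure PathPresentation (k : Type u) (V : Type v) (A : Type u') [Field k]
    [Quiver.{w} V] [Fintype V] [Ring A] [Algebra k A] where
  /-- the member of the family attached to a path -/
  elt : ∀ {a b : V}, Path a b → A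
  elt_mul_elt : ∀ {a b c : V} (p : Path a b) (q : Path b c), elt p * elt q = elt (p.comp q)
  elt_mul_elt_of_ne : ∀ {a b b' c : V} (p : Path a b) (q : Path b' c), b ≠ b' → elt p * elt q = 0
  /-- the coordinates of an element -/
  coef : A →ₗ[k] (AnyPath V →₀ k)
  coef_injective : Function.Injective coef
  coef_elt : ∀ {a b : V} (p : Path a b), elt p ≠ 0 → coef (elt p) = Finsupp.single ⟨a, b, p⟩ 1
  span_elt : Submodule.span k (Set.range fun p : AnyPath V => elt p.2.2) = ⊤

namespace PathPresentation

variable {k : Type u} {V : Type v} {A : Type u'} [Field k] [Quiver.{w} V] [Fintype V]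
  [Ring A] [Algebra k A] (B : PathPresentation k V A)

theorem induction {motive : A → Prop} (x : A)
    (path : ∀ {a b : V} (p : Path a b), B.elt p ≠ 0 → motive (B.elt p)) (zero : motive 0)
    (add : ∀ x y, motive x → motive y → motive (x + y))
    (smul : ∀ (r : k) x, motive x → motive (r • x)) : motive x := by
  have hx : x ∈ Submodule.span k (Set.range fun p : AnyPath V => B.elt p.2.2) := by
    rw [B.span_elt]; trivial
  induction hx using Submodule.span_induction with
  | mem x h =>
    obtain ⟨⟨a, b, p⟩, rfl⟩ := h
    by_cases hp : B.elt p = 0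
    · simpa [hp] using zero
    · exact path p hp
  | zero => exact zero
  | add x y _ _ hx hy => exact add x y hx hy
  | smul r x _ hx => exact smul r x hx

/-- The nonzero members of the family already span, and the coordinate vector of each is
concentrated at its own path; hence no vanishing path ever receives a coefficient. -/
theorem coef_eq_zero_of_elt_eq_zero (x : A) {a b : V} (p : Path a b) (hp : B.elt p = 0) :
    B.coef x ⟨a, b, p⟩ = 0 := by
  classical
  induction x using B.induction with
  | @path c d q hq =>
    rw [B.coef_elt q hq, Finsupp.single_apply, if_neg]
    intro h
    obtain ⟨rfl, h⟩ := Sigma.mk.inj_iff.mp h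
    obtain ⟨rfl, h⟩ := Sigma.mk.inj_iff.mp (eq_of_heq h)
    exact hq (eq_of_heq h ▸ hp)
  | zero => simp
  | add x y hx hy => simp [hx, hy]
  | smul r x hx => simp [hx]

theorem elt_ne_zero {x : A} {a b : V} {p : Path a b} (h : B.coef x ⟨a, b, p⟩ ≠ 0) :
    B.elt p ≠ 0 := fun hp => h (B.coef_eq_zero_of_elt_eq_zero x p hp)

theorem eq_zero_of_coef {x : A} (h : ∀ {a b : V} (p : Path a b), B.coef x ⟨a, b, p⟩ = 0) :
    x = 0 := by
  apply B.coef_injective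
  rw [map_zero]
  ext ⟨a, b, p⟩
  exact h p

theorem exists_coef_ne_zero {x : A} (hx : x ≠ 0) :
    ∃ (a b : V) (p : Path a b), B.coef x ⟨a, b, p⟩ ≠ 0 := by
  by_contra! h
  exact hx (B.eq_zero_of_coef fun {a b} p => h a b p)

theorem sum_coef_smul_elt (x : A) : (B.coef x).sum (fun p c => c • B.elt p.2.2) = x := by
  have key : (Finsupp.linearCombination k fun p : AnyPath V => B.elt p.2.2) (B.coef x) = x := by
    induction x using B.induction with
    | @path c d q hq => rw [B.coef_elt q hq]; simp
    | zero => simp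
    | add x y hx hy => rw [map_add, map_add, hx, hy]
    | smul r x hx => rw [map_smul, map_smul, hx]
  exact key

/-- To prove that an element lies in a `k`-subspace it suffices to consider its support. -/
theorem mem_of_coef (S : Submodule k A) {x : A}
    (h : ∀ {a b : V} (p : Path a b), B.coef x ⟨a, b, p⟩ ≠ 0 → B.elt p ∈ S) : x ∈ S := by
  rw [← B.sum_coef_smul_elt x]
  exact Submodule.sum_mem _ fun p hp => S.smul_mem _ (h p.2.2 (Finsupp.mem_support_iff.mp hp))

theorem coef_elt_self {a b : V} (p : Path a b) (hp : B.elt p ≠ 0) :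
    B.coef (B.elt p) ⟨a, b, p⟩ = 1 := by
  rw [B.coef_elt p hp, Finsupp.single_eq_same]

theorem coef_elt_ne {a b : V} (p : Path a b) (q : AnyPath V) (h : (⟨a, b, p⟩ : AnyPath V) ≠ q) :
    B.coef (B.elt p) q = 0 := by
  by_cases hp : B.elt p = 0
  · simp [hp]
  · rw [B.coef_elt p hp, Finsupp.single_eq_of_ne (Ne.symm h)]

/-- Right multiplication by a path is injective on paths, so nothing but `w` can contribute to `wq`.
The product has to be nonzero, since otherwise its coefficient is lost. -/
theorem coef_mul_elt (x : A) {a b c : V} (w : Path a b) (q : Path b c)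
    (h : B.elt (w.comp q) ≠ 0) :
    B.coef (x * B.elt q) ⟨a, c, w.comp q⟩ = B.coef x ⟨a, b, w⟩ := by
  induction x using B.induction with
  | zero => simp
  | add x y hx hy => simp [add_mul, hx, hy]
  | smul r x hx => simp [hx]
  | @path a' b' w' hw' =>
    by_cases hb : b' = b
    · subst hb
      rw [B.elt_mul_elt]
      by_cases e : (⟨a', b', w'⟩ : AnyPath V) = ⟨a, b', w⟩
      · obtain ⟨rfl, e⟩ := Sigma.mk.inj_iff.mp e
        obtain ⟨-, e⟩ := Sigma.mk.inj_iff.mp (eq_of_heq e)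
        obtain rfl := eq_of_heq e
        rw [B.coef_elt_self _ h, B.coef_elt_self _ hw']
      · rw [B.coef_elt_ne _ _ e, B.coef_elt_ne]
        intro e'
        obtain ⟨rfl, e'⟩ := Sigma.mk.inj_iff.mp e'
        obtain ⟨-, e'⟩ := Sigma.mk.inj_iff.mp (eq_of_heq e')
        rw [Path.comp_inj_left.mp (eq_of_heq e')] at e
        exact e rfl
    · rw [B.elt_mul_elt_of_ne _ _ hb, B.coef_elt_ne]
      · simp
      · intro e
        obtain ⟨rfl, e⟩ := Sigma.mk.inj_iff.mp e
        exact hb (Sigma.mk.inj_iff.mp (eq_of_heq e)).1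

theorem coef_elt_mul (x : A) {a b c : V} (q : Path a b) (w : Path b c)
    (h : B.elt (q.comp w) ≠ 0) :
    B.coef (B.elt q * x) ⟨a, c, q.comp w⟩ = B.coef x ⟨b, c, w⟩ := by
  induction x using B.induction with
  | zero => simp
  | add x y hx hy => simp [mul_add, hx, hy]
  | smul r x hx => simp [hx]
  | @path b' c' w' hw' =>
    by_cases hb : b = b'
    · subst hb
      rw [B.elt_mul_elt]
      by_cases e : (⟨b, c', w'⟩ : AnyPath V) = ⟨b, c, w⟩
      · obtain ⟨-, e⟩ := Sigma.mk.inj_iff.mp e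
        obtain ⟨rfl, e⟩ := Sigma.mk.inj_iff.mp (eq_of_heq e)
        obtain rfl := eq_of_heq e
        rw [B.coef_elt_self _ h, B.coef_elt_self _ hw']
      · rw [B.coef_elt_ne _ _ e, B.coef_elt_ne]
        intro e'
        obtain ⟨-, e'⟩ := Sigma.mk.inj_iff.mp e'
        obtain ⟨rfl, e'⟩ := Sigma.mk.inj_iff.mp (eq_of_heq e')
        rw [Path.comp_inj_right.mp (eq_of_heq e')] at e
        exact e rfl
    · rw [B.elt_mul_elt_of_ne _ _ hb, B.coef_elt_ne]
      · simp
      · intro e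
        exact hb (Sigma.mk.inj_iff.mp e).1.symm

theorem exists_eq_comp_of_coef_mul_elt (x : A) {a b c d : V} (q : Path b c) (p : Path a d)
    (h : B.coef (x * B.elt q) ⟨a, d, p⟩ ≠ 0) :
    ∃ (w : Path a b), (⟨a, d, p⟩ : AnyPath V) = ⟨a, c, w.comp q⟩ ∧ B.coef x ⟨a, b, w⟩ ≠ 0 := by
  suffices H : ∃ (w : Path a b), (⟨a, d, p⟩ : AnyPath V) = ⟨a, c, w.comp q⟩ by
    obtain ⟨w, hw⟩ := H
    obtain ⟨-, e⟩ := Sigma.mk.inj_iff.mp hw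
    obtain ⟨rfl, e⟩ := Sigma.mk.inj_iff.mp (eq_of_heq e)
    obtain rfl := eq_of_heq e
    exact ⟨w, rfl, by rwa [B.coef_mul_elt _ _ _ (B.elt_ne_zero h)] at h⟩
  contrapose! h
  induction x using B.induction with
  | zero => simp
  | add x y hx hy => simp [add_mul, hx, hy]
  | smul r x hx => simp [hx]
  | @path a' b' w' hw' =>
    by_cases hb : b' = b
    · subst hb
      rw [B.elt_mul_elt, B.coef_elt_ne]
      intro e
      obtain ⟨rfl, -⟩ := Sigma.mk.inj_iff.mp e
      exact h w' e.symm
    · simp [B.elt_mul_elt_of_ne _ _ hb]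

theorem elt_nil_mul {a b : V} (p : Path a b) : B.elt (Path.nil : Path a a) * B.elt p = B.elt p := by
  rw [B.elt_mul_elt, Path.nil_comp]

theorem elt_mul_nil {a b : V} (p : Path a b) : B.elt p * B.elt (Path.nil : Path b b) = B.elt p := by
  rw [B.elt_mul_elt, Path.comp_nil]

theorem elt_cons {a b c : V} (p : Path a b) (β : b ⟶ c) :
    B.elt (p.cons β) = B.elt p * B.elt β.toPath := by
  rw [B.elt_mul_elt]; rfl

theorem elt_ne_zero_left {a b c : V} {p : Path a b} {q : Path b c} (h : B.elt (p.comp q) ≠ 0) :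
    B.elt p ≠ 0 := fun hp => h (by rw [← B.elt_mul_elt, hp, zero_mul])

theorem elt_ne_zero_right {a b c : V} {p : Path a b} {q : Path b c} (h : B.elt (p.comp q) ≠ 0) :
    B.elt q ≠ 0 := fun hp => h (by rw [← B.elt_mul_elt, hp, mul_zero])

theorem elt_comp_eq_zero_of_mul_elt_eq_zero {x : A} {b c : V} {q : Path b c}
    (h : x * B.elt q = 0) {a : V} {w : Path a b} (hw : B.coef x ⟨a, b, w⟩ ≠ 0) :
    B.elt (w.comp q) = 0 := by
  by_contra h'
  rw [← B.coef_mul_elt x w q h', h] at hw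
  simp at hw

theorem elt_comp_eq_zero_of_elt_mul_eq_zero {x : A} {a b : V} {q : Path a b}
    (h : B.elt q * x = 0) {c : V} {w : Path b c} (hw : B.coef x ⟨b, c, w⟩ ≠ 0) :
    B.elt (q.comp w) = 0 := by
  by_contra h'
  rw [← B.coef_elt_mul x q w h', h] at hw
  simp at hw

theorem coef_nil_mul_of_ne (x : A) {a b c : V} (p : Path b c) (h : a ≠ b) :
    B.coef (B.elt (Path.nil : Path a a) * x) ⟨b, c, p⟩ = 0 := by
  induction x using B.induction with
  | zero => simp
  | add x y hx hy => simp [mul_add, hx, hy]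
  | smul r x hx => simp [hx]
  | @path a' b' w' hw' =>
    by_cases hb : a = a'
    · subst hb
      rw [B.elt_nil_mul, B.coef_elt_ne]
      intro e
      exact h (Sigma.mk.inj_iff.mp e).1
    · simp [B.elt_mul_elt_of_ne _ _ hb]

theorem coef_mul_nil_of_ne (x : A) {a b c : V} (p : Path b c) (h : a ≠ c) :
    B.coef (x * B.elt (Path.nil : Path a a)) ⟨b, c, p⟩ = 0 := by
  by_contra h'
  obtain ⟨w, e, -⟩ := B.exists_eq_comp_of_coef_mul_elt _ _ _ h'
  exact h (Sigma.mk.inj_iff.mp (eq_of_heq (Sigma.mk.inj_iff.mp e).2)).1.symm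

theorem coef_nil_mul (x : A) {b c : V} (p : Path b c) :
    B.coef (B.elt (Path.nil : Path b b) * x) ⟨b, c, p⟩ = B.coef x ⟨b, c, p⟩ := by
  by_cases hp : B.elt p = 0
  · simp [B.coef_eq_zero_of_elt_eq_zero _ _ hp]
  · have := B.coef_elt_mul x (Path.nil : Path b b) p (by rwa [Path.nil_comp])
    rwa [Path.nil_comp] at this

theorem coef_mul_nil (x : A) {b c : V} (p : Path b c) :
    B.coef (x * B.elt (Path.nil : Path c c)) ⟨b, c, p⟩ = B.coef x ⟨b, c, p⟩ := by
  by_cases hp : B.elt p = 0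
  · simp [B.coef_eq_zero_of_elt_eq_zero _ _ hp]
  · have := B.coef_mul_elt x p (Path.nil : Path c c) (by rwa [Path.comp_nil])
    rwa [Path.comp_nil] at this

/-- Nonzero paths are bounded in length. -/
def BoundedBy (N : ℕ) : Prop := ∀ {a b : V} (p : Path a b), N ≤ p.length → B.elt p = 0

/-- The span of the paths of length at least `j`. -/
def layer (j : ℕ) : Submodule k A :=
  Submodule.span k {x | ∃ (a b : V) (p : Path a b), j ≤ p.length ∧ x = B.elt p}

theorem mul_mem_layer {i j : ℕ} {x y : A} (hx : x ∈ B.layer i) (hy : y ∈ B.layer j) :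
    x * y ∈ B.layer (i + j) := by
  have : B.layer i * B.layer j ≤ B.layer (i + j) := by
    rw [layer, layer, Submodule.span_mul_span, Submodule.span_le]
    rintro _ ⟨_, ⟨a, b, p, hp, rfl⟩, _, ⟨c, d, q, hq, rfl⟩, rfl⟩
    by_cases hb : b = c
    · subst hb
      exact Submodule.subset_span ⟨a, d, p.comp q, by rw [Path.length_comp]; omega,
        B.elt_mul_elt p q⟩
    · simp [B.elt_mul_elt_of_ne _ _ hb]
  exact this (Submodule.mul_mem_mul hx hy)

theorem mem_layer_one_of_coef_nil {x : A} (h : ∀ a, B.coef x ⟨a, a, Path.nil⟩ = 0) :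
    x ∈ B.layer 1 := by
  refine B.mem_of_coef _ fun {a b} p hp => ?_
  cases p with
  | nil => exact absurd (h a) hp
  | cons p e => exact Submodule.subset_span ⟨_, _, _, by simp, rfl⟩

variable {B} in
theorem BoundedBy.layer_eq_bot {N : ℕ} (hN : B.BoundedBy N) : B.layer N = ⊥ := by
  rw [layer, Submodule.span_eq_bot]
  rintro _ ⟨a, b, p, hp, rfl⟩
  exact hN p hp

-- Without trivial paths in its support, the element lies in the span of the arrows and longer
-- paths, and this span is nilpotent because long paths vanish.
variable {B} in
theorem BoundedBy.isNilpotent {N : ℕ} (hN : B.BoundedBy N) {x : A}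
    (h : ∀ a, B.coef x ⟨a, a, Path.nil⟩ = 0) : IsNilpotent x := by
  have key : ∀ j, x ^ (j + 1) ∈ B.layer (j + 1) := by
    intro j
    induction j with
    | zero => simpa using B.mem_layer_one_of_coef_nil h
    | succ j ih => rw [pow_succ]; exact B.mul_mem_layer ih (B.mem_layer_one_of_coef_nil h)
  refine ⟨N + 1, ?_⟩
  have h1 := key N
  have hN' : B.BoundedBy (N + 1) := fun p hp => hN p (by omega)
  rwa [hN'.layer_eq_bot, Submodule.mem_bot] at h1

variable {B} in
theorem BoundedBy.isUnit_add {N : ℕ} (hN : B.BoundedBy N) {c : k} (hc : c ≠ 0) {x : A}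
    (h : ∀ a, B.coef x ⟨a, a, Path.nil⟩ = 0) : IsUnit (algebraMap k A c + x) :=
  (hN.isNilpotent h).isUnit_add_left_of_commute
    ((Ne.isUnit hc).map (algebraMap k A)) (Algebra.commutes c x).symm

end PathPresentation

/-! ### Vanishing of extension groups and syzygies -/

section Ext

open CategoryTheory CategoryTheory.Abelian

variable {R : Type u} [Ring R] (N : Type u) [AddCommGroup N] [Module R N]
  {K Q M M' : Type u} [AddCommGroup K] [Module R K] [AddCommGroup Q] [Module R Q]
  [AddCommGroup M] [Module R M] [AddCommGroup M'] [Module R M']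

variable (R) in
/-- All higher extension groups of `M` by `N` vanish. -/
def ExtVanish (M : Type u) [AddCommGroup M] [Module R M] : Prop :=
  ∀ (n : ℕ) (x : Ext (ModuleCat.of R M) (ModuleCat.of R N) (n + 1)), x = 0

variable {N}

theorem ExtVanish.of_retract (h : ExtVanish R N M) (i : M' →ₗ[R] M) (r : M →ₗ[R] M')
    (hri : r ∘ₗ i = LinearMap.id) : ExtVanish R N M' := by
  intro n x
  have h1 : (Ext.mk₀ (ModuleCat.ofHom i)).comp
      ((Ext.mk₀ (ModuleCat.ofHom r)).comp x (zero_add _)) (zero_add _) = x := by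
    rw [Ext.mk₀_comp_mk₀_assoc, ← ModuleCat.ofHom_comp, hri]
    exact Ext.mk₀_id_comp x
  rw [← h1, h n ((Ext.mk₀ (ModuleCat.ofHom r)).comp x (zero_add _))]
  exact Ext.comp_zero _ _ _ _ _

section ShortComplex

variable {C : Type v} [Category.{w} C] [Abelian C] [HasExt.{u} C] {S : ShortComplex C}
  {Y : C}

theorem ext_shortComplex_eq_zero [Projective S.X₂] (hS : S.ShortExact) (n : ℕ)
    (h : ∀ x : Ext S.X₃ Y (n + 1 + 1), x = 0)
    (x : Ext S.X₁ Y (n + 1)) : x = 0 := by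
  obtain ⟨y, hy⟩ := Ext.contravariant_sequence_exact₁ hS _ x
    (show 1 + (n + 1) = n + 1 + 1 by omega) (h _)
  rw [← hy, Ext.eq_zero_of_projective y, Ext.comp_zero]

theorem exists_comp_of_ext_eq_zero (hS : S.ShortExact) (h : ∀ x : Ext S.X₃ Y (0 + 1), x = 0)
    (φ : S.X₁ ⟶ Y) : ∃ ψ : S.X₂ ⟶ Y, S.f ≫ ψ = φ := by
  obtain ⟨y, hy⟩ := Ext.contravariant_sequence_exact₁ hS _ (Ext.mk₀ φ)
    (show 1 + 0 = 0 + 1 by omega) (h _)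
  obtain ⟨ψ, rfl⟩ := (Ext.mk₀_bijective _ _).2 y
  rw [Ext.mk₀_comp_mk₀] at hy
  exact ⟨ψ, (Ext.mk₀_bijective _ _).1 hy⟩

/-- Projectivity of the middle term makes every class the product of the extension class with a map
`φ` on the left term. If `φ` factors through `S.f`, the product contains the extension class times
`S.f`, which is zero. -/
theorem ext_one_eq_zero_of_exists_comp [Projective S.X₂] (hS : S.ShortExact)
    (h : ∀ φ : S.X₁ ⟶ Y, ∃ ψ : S.X₂ ⟶ Y, S.f ≫ ψ = φ)
    (x : Ext S.X₃ Y (0 + 1)) : x = 0 := by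
  obtain ⟨y, hy⟩ := Ext.contravariant_sequence_exact₃ hS _ x
    (Ext.eq_zero_of_projective (n := 0) _) (show 1 + 0 = 0 + 1 by omega)
  obtain ⟨φ, rfl⟩ := (Ext.mk₀_bijective _ _).2 y
  obtain ⟨ψ, rfl⟩ := h φ
  rw [← hy, ← Ext.mk₀_comp_mk₀, ← Ext.comp_assoc _ _ _ (add_zero 1) (zero_add 0) (by omega),
    hS.extClass_comp, Ext.zero_comp]

theorem ext_shortComplex_succ_eq_zero [Projective S.X₂] (hS : S.ShortExact) (n : ℕ)
    (h : ∀ x : Ext S.X₁ Y (n + 1), x = 0)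
    (x : Ext S.X₃ Y (n + 1 + 1)) : x = 0 := by
  obtain ⟨y, hy⟩ := Ext.contravariant_sequence_exact₃ hS _ x
    (Ext.eq_zero_of_projective _) (show 1 + (n + 1) = n + 1 + 1 by omega)
  rw [← hy, h y, Ext.comp_zero]

end ShortComplex

variable {f : K →ₗ[R] Q} {g : Q →ₗ[R] M}

theorem shortExact_moduleCatMk (hf : Function.Injective f) (hfg : Function.Exact f g)
    (hg : Function.Surjective g) :
    (ShortComplex.moduleCatMk f g hfg.linearMap_comp_eq_zero).ShortExact where
  exact := (ShortComplex.ShortExact.moduleCat_exact_iff_function_exact _).mpr hfg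
  mono_f := (ModuleCat.mono_iff_injective _).mpr hf
  epi_g := (ModuleCat.epi_iff_surjective _).mpr hg

theorem ExtVanish.syzygy [Module.Projective R Q] (hf : Function.Injective f)
    (hfg : Function.Exact f g) (hg : Function.Surjective g) (h : ExtVanish R N M) :
    ExtVanish R N K := by
  intro n x
  have : Projective (ShortComplex.moduleCatMk f g hfg.linearMap_comp_eq_zero).X₂ :=
    inferInstanceAs (Projective (ModuleCat.of R Q))
  exact ext_shortComplex_eq_zero (shortExact_moduleCatMk hf hfg hg) n (h _) x

theorem ExtVanish.exists_extend (hf : Function.Injective f)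
    (hfg : Function.Exact f g) (hg : Function.Surjective g) (h : ExtVanish R N M)
    (φ : K →ₗ[R] N) : ∃ ψ : Q →ₗ[R] N, ψ ∘ₗ f = φ := by
  obtain ⟨ψ, hψ⟩ := exists_comp_of_ext_eq_zero (shortExact_moduleCatMk hf hfg hg)
    (Y := ModuleCat.of R N) (h 0) (ModuleCat.ofHom φ)
  exact ⟨ψ.hom, ModuleCat.hom_ext_iff.mp hψ⟩

theorem ext_one_eq_zero_of_exists_extend [Module.Projective R Q] (hf : Function.Injective f)
    (hfg : Function.Exact f g) (hg : Function.Surjective g)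
    (h : ∀ φ : K →ₗ[R] N, ∃ ψ : Q →ₗ[R] N, ψ ∘ₗ f = φ)
    (x : Ext (ModuleCat.of R M) (ModuleCat.of R N) (0 + 1)) : x = 0 := by
  have : Projective (ShortComplex.moduleCatMk f g hfg.linearMap_comp_eq_zero).X₂ :=
    inferInstanceAs (Projective (ModuleCat.of R Q))
  refine ext_one_eq_zero_of_exists_comp (shortExact_moduleCatMk hf hfg hg) (fun φ => ?_) x
  obtain ⟨ψ, hψ⟩ := h φ.hom
  exact ⟨ModuleCat.ofHom ψ, ModuleCat.hom_ext hψ⟩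

theorem ext_succ_eq_zero_of_syzygy [Module.Projective R Q] (hf : Function.Injective f)
    (hfg : Function.Exact f g) (hg : Function.Surjective g) (n : ℕ)
    (h : ∀ x : Ext (ModuleCat.of R K) (ModuleCat.of R N) (n + 1), x = 0)
    (x : Ext (ModuleCat.of R M) (ModuleCat.of R N) (n + 1 + 1)) : x = 0 := by
  have : Projective (ShortComplex.moduleCatMk f g hfg.linearMap_comp_eq_zero).X₂ :=
    inferInstanceAs (Projective (ModuleCat.of R Q))
  exact ext_shortComplex_succ_eq_zero (shortExact_moduleCatMk hf hfg hg) n h x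

end Ext

/-! ### Consequences of Gorenstein-projectivity -/

section Gorenstein

variable {A : Type u} [Ring A]

variable (A) in
/-- The regular right module, as a module over the opposite ring, is free of rank one. -/
def opLinearEquiv : Aᵐᵒᵖ ≃ₗ[Aᵐᵒᵖ] A where
  toFun x := x.unop
  invFun x := MulOpposite.op x
  map_add' _ _ := rfl
  map_smul' _ _ := rfl

instance : Module.Projective Aᵐᵒᵖ A := Module.Projective.of_equiv (opLinearEquiv A)

theorem exists_retract_pi (P : Type u) [AddCommGroup P] [Module Aᵐᵒᵖ P] [Module.Finite Aᵐᵒᵖ P]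
    [Module.Projective Aᵐᵒᵖ P] :
    ∃ (n : ℕ) (s : P →ₗ[Aᵐᵒᵖ] (Fin n → A)) (r : (Fin n → A) →ₗ[Aᵐᵒᵖ] P),
      r ∘ₗ s = LinearMap.id := by
  obtain ⟨n, g, hg⟩ := Module.Finite.exists_fin' Aᵐᵒᵖ P
  obtain ⟨s, hs⟩ := Module.projective_lifting_property g LinearMap.id hg
  let E : (Fin n → Aᵐᵒᵖ) ≃ₗ[Aᵐᵒᵖ] (Fin n → A) :=
    LinearEquiv.piCongrRight fun _ => opLinearEquiv A
  refine ⟨n, E.toLinearMap ∘ₗ s, g ∘ₗ E.symm.toLinearMap, ?_⟩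
  ext x
  simpa using LinearMap.congr_fun hs x

variable (A) in
/-- `G` embeds into a free right module of finite rank, as a kernel of a map to a product of copies
of the regular module, and all linear forms on `G` extend. -/
def IsReflexiveKernel (G : Type u) [AddCommGroup G] [Module Aᵐᵒᵖ G] : Prop :=
  ∃ (ι κ : Type) (_ : Finite ι) (i : G →ₗ[Aᵐᵒᵖ] (ι → A)) (f : (ι → A) →ₗ[Aᵐᵒᵖ] (κ → A)),
    Function.Injective i ∧ Function.Exact i f ∧
      ∀ φ : G →ₗ[Aᵐᵒᵖ] A, ∃ ψ : (ι → A) →ₗ[Aᵐᵒᵖ] A, ψ ∘ₗ i = φ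

variable {G H : Type u} [AddCommGroup G] [Module Aᵐᵒᵖ G] [AddCommGroup H] [Module Aᵐᵒᵖ H]

/-- The summand `H` is cut out of `G` by the equation `y = i (r y)`. Its coordinates are linear
forms on `G`, so they extend to the free module and can be added to the equations `f` defining `G`.
-/
theorem IsReflexiveKernel.of_retract (h : IsReflexiveKernel A G) (i : H →ₗ[Aᵐᵒᵖ] G)
    (r : G →ₗ[Aᵐᵒᵖ] H) (hri : r ∘ₗ i = LinearMap.id) : IsReflexiveKernel A H := by
  obtain ⟨ι, κ, hι, j, f, hj, hjf, hext⟩ := h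
  have hri' (x : H) : r (i x) = x := LinearMap.congr_fun hri x
  choose ψ hψ using fun c : ι =>
    hext (LinearMap.proj c ∘ₗ j ∘ₗ (LinearMap.id - i ∘ₗ r))
  have hψ' (c : ι) (y : G) : ψ c (j y) = j (y - i (r y)) c := LinearMap.congr_fun (hψ c) y
  refine ⟨ι, κ ⊕ ι, hι, j ∘ₗ i,
    LinearMap.pi (Sum.elim (fun c => LinearMap.proj c ∘ₗ f) ψ), ?_, ?_, ?_⟩
  · refine hj.comp fun x y hxy => ?_
    rw [← hri' x, hxy, hri']
  · intro x
    constructor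
    · intro hx
      have hfx : f x = 0 := by
        ext c
        simpa using congr_fun hx (Sum.inl c)
      obtain ⟨y, rfl⟩ := (hjf x).mp hfx
      have hy : j (y - i (r y)) = 0 := by
        ext c
        rw [← hψ']
        simpa using congr_fun hx (Sum.inr c)
      refine ⟨r y, ?_⟩
      rw [map_eq_zero_iff _ hj, sub_eq_zero] at hy
      exact (congrArg j hy).symm
    · rintro ⟨y, rfl⟩
      ext (c | c)
      · simp [hjf.apply_apply_eq_zero]
      · simp [hψ', hri']
  · intro φ
    obtain ⟨χ, hχ⟩ := hext (φ ∘ₗ r)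
    refine ⟨χ, ?_⟩
    rw [← LinearMap.comp_assoc, hχ, LinearMap.comp_assoc, hri, LinearMap.comp_id]

section Complex

variable {P : ℤ → Type u} [∀ i, AddCommGroup (P i)] [∀ i, Module Aᵐᵒᵖ (P i)]
  {d : ∀ i, P i →ₗ[Aᵐᵒᵖ] P (i + 1)}

/-- Pulled back along the differential, `φ` kills the preceding image, so it is a cocycle of the
dual complex; exactness of that complex provides the extension. -/
theorem exists_extend_range (hd : ∀ i, Function.Exact (d i) (d (i + 1)))
    (hA : ∀ i, Function.Exact
      (fun f : P (i + 1 + 1) →ₗ[Aᵐᵒᵖ] A => f ∘ₗ d (i + 1))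
      (fun f : P (i + 1) →ₗ[Aᵐᵒᵖ] A => f ∘ₗ d i)) (i : ℤ)
    (φ : LinearMap.range (d i) →ₗ[Aᵐᵒᵖ] A) :
    ∃ ψ : P (i + 1) →ₗ[Aᵐᵒᵖ] A, ψ ∘ₗ (LinearMap.range (d i)).subtype = φ := by
  obtain ⟨j, rfl⟩ : ∃ j, i = j + 1 := ⟨i - 1, by ring⟩
  obtain ⟨ψ, hψ⟩ := (hA j (φ ∘ₗ (d (j + 1)).rangeRestrict)).mp (by
    ext x
    have : (d (j + 1)).rangeRestrict (d j x) = 0 :=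
      Subtype.ext ((hd j).apply_apply_eq_zero x)
    simp [this])
  refine ⟨ψ, ?_⟩
  ext ⟨_, x, rfl⟩
  exact LinearMap.congr_fun hψ x

/-- Each image is the first syzygy of the next one. Extension of forms gives the vanishing in degree
one, simultaneously for all images, and dimension shifting along the complex gives the higher
degrees. -/
theorem ext_range_eq_zero [∀ i, Module.Projective Aᵐᵒᵖ (P i)]
    (hd : ∀ i, Function.Exact (d i) (d (i + 1)))
    (hA : ∀ i, Function.Exact
      (fun f : P (i + 1 + 1) →ₗ[Aᵐᵒᵖ] A => f ∘ₗ d (i + 1))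
      (fun f : P (i + 1) →ₗ[Aᵐᵒᵖ] A => f ∘ₗ d i)) (i : ℤ) :
    ExtVanish Aᵐᵒᵖ A (LinearMap.range (d i)) := by
  intro n
  induction n generalizing i with
  | zero =>
    obtain ⟨j, rfl⟩ : ∃ j, i = j + 1 := ⟨i - 1, by ring⟩
    refine ext_one_eq_zero_of_exists_extend (f := (LinearMap.range (d j)).subtype)
      (g := (d (j + 1)).rangeRestrict) (Subtype.val_injective) ?_
      (LinearMap.surjective_rangeRestrict _) (exists_extend_range hd hA j)
    rw [LinearMap.exact_iff, LinearMap.ker_rangeRestrict, Submodule.range_subtype,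
      (hd j).linearMap_ker_eq]
  | succ n ih =>
    obtain ⟨j, rfl⟩ : ∃ j, i = j + 1 := ⟨i - 1, by ring⟩
    refine ext_succ_eq_zero_of_syzygy (f := (LinearMap.range (d j)).subtype)
      (g := (d (j + 1)).rangeRestrict) (Subtype.val_injective) ?_
      (LinearMap.surjective_rangeRestrict _) n (ih j)
    rw [LinearMap.exact_iff, LinearMap.ker_rangeRestrict, Submodule.range_subtype,
      (hd j).linearMap_ker_eq]

end Complex

theorem IsGorensteinProjective.finite (h : IsGorensteinProjective A G) :
    Module.Finite Aᵐᵒᵖ G := by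
  obtain ⟨P, _, _, d, hf, -, -, -, ⟨e⟩⟩ := h
  have := hf (-1)
  exact Module.Finite.equiv e.symm

theorem IsGorensteinProjective.extVanish (h : IsGorensteinProjective A G) :
    ExtVanish Aᵐᵒᵖ A G := by
  obtain ⟨P, _, _, d, -, hp, hd, hA, ⟨e⟩⟩ := h
  exact (ext_range_eq_zero hd hA (-1)).of_retract e.toLinearMap e.symm.toLinearMap (by ext; simp)

theorem IsGorensteinProjective.isReflexiveKernel (h : IsGorensteinProjective A G) :
    IsReflexiveKernel A G := by
  obtain ⟨P, _, _, d, hf, hp, hd, hA, ⟨e⟩⟩ := h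
  suffices H : IsReflexiveKernel A (LinearMap.range (d (-1))) from
    H.of_retract e.toLinearMap e.symm.toLinearMap (by ext; simp)
  have := hf (-1 + 1); have := hf (-1 + 1 + 1); have := hp (-1 + 1); have := hp (-1 + 1 + 1)
  obtain ⟨n, s, r, hrs⟩ := exists_retract_pi (A := A) (P (-1 + 1))
  obtain ⟨m, s', r', hrs'⟩ := exists_retract_pi (A := A) (P (-1 + 1 + 1))
  have hrs (x) : r (s x) = x := LinearMap.congr_fun hrs x
  have hrs' (x) : r' (s' x) = x := LinearMap.congr_fun hrs' x
  -- The image is the kernel of the next differential in a summand of `Aⁿ`. The first block of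
  -- equations expresses that kernel, the second says that a vector belongs to the summand.
  refine ⟨Fin n, Fin m ⊕ Fin n, inferInstance, s ∘ₗ (LinearMap.range (d (-1))).subtype,
    LinearMap.pi (Sum.elim (fun c => LinearMap.proj c ∘ₗ s' ∘ₗ d (-1 + 1) ∘ₗ r)
      fun c => LinearMap.proj c ∘ₗ (LinearMap.id - s ∘ₗ r)), ?_, ?_, ?_⟩
  · exact (Function.LeftInverse.injective hrs).comp Subtype.val_injective
  · intro x
    constructor
    · intro hx
      have h1 : s' (d (-1 + 1) (r x)) = 0 := by
        ext c
        exact congr_fun hx (Sum.inl c)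
      have h2 : x - s (r x) = 0 := by
        ext c
        exact congr_fun hx (Sum.inr c)
      rw [map_eq_zero_iff _ (Function.LeftInverse.injective hrs')] at h1
      obtain ⟨y, hy⟩ := (hd (-1) _).mp h1
      exact ⟨⟨r x, y, hy⟩, (sub_eq_zero.mp h2).symm⟩
    · rintro ⟨⟨_, y, rfl⟩, rfl⟩
      have h1 := (hd (-1)).apply_apply_eq_zero y
      ext (c | c)
      · change s' (d (-1 + 1) (r (s (d (-1) y)))) c = 0
        rw [hrs, h1, map_zero, Pi.zero_apply]
      · change s (d (-1) y) c - s (r (s (d (-1) y))) c = 0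
        rw [hrs, sub_self]
  · intro φ
    obtain ⟨ψ, hψ⟩ := exists_extend_range hd hA (-1) φ
    refine ⟨ψ ∘ₗ r, ?_⟩
    rw [← hψ]
    ext x
    simp [hrs]

theorem isGorensteinProjective_of_projective [Module.Finite Aᵐᵒᵖ G] [Module.Projective Aᵐᵒᵖ G] :
    IsGorensteinProjective A G := by
  -- The contractible complex with `D (x, y) = (0, x)` in every degree: kernel and image are both
  -- the second factor.
  let D : G × G →ₗ[Aᵐᵒᵖ] G × G := LinearMap.inr Aᵐᵒᵖ G G ∘ₗ LinearMap.fst Aᵐᵒᵖ G G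
  have hD' (z : G × G) : D z = (0, z.1) := rfl
  have hD : Function.Exact D D := by
    intro z
    constructor
    · intro h
      rw [hD', Prod.mk_eq_zero] at h
      exact ⟨(z.2, 0), Prod.ext h.2.symm rfl⟩
    · rintro ⟨z, rfl⟩
      rfl
  refine ⟨fun _ => G × G, fun _ => inferInstance, fun _ => inferInstance, fun _ => D,
    fun _ => inferInstance, fun _ => inferInstance, fun _ => hD, fun _ f => ⟨fun hf => ?_, ?_⟩, ?_⟩
  · refine ⟨f ∘ₗ LinearMap.inl Aᵐᵒᵖ G G ∘ₗ LinearMap.snd Aᵐᵒᵖ G G, ?_⟩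
    have h0 (y : G) : f (0, y) = 0 := LinearMap.congr_fun hf (y, 0)
    ext x
    · simp [D]
    · simp [D, h0]
  · rintro ⟨g, rfl⟩
    refine LinearMap.ext fun z => ?_
    exact g.map_zero
  · refine ⟨LinearEquiv.ofBijective
      (D.rangeRestrict ∘ₗ LinearMap.inl Aᵐᵒᵖ G G) ⟨?_, ?_⟩⟩
    · intro x y hxy
      exact congrArg Prod.snd (congrArg Subtype.val hxy)
    · rintro ⟨_, ⟨x, y⟩, rfl⟩
      exact ⟨x, Subtype.ext (by simp [D])⟩

end Gorenstein

/-! ### Left multiplications, and paths with a given last arrow -/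

section LeftMultiplication

variable {A : Type u} [Ring A]

/-- Left multiplication, as a map of right modules. -/
def lmul (a : A) : A →ₗ[Aᵐᵒᵖ] A where
  toFun x := a * x
  map_add' := mul_add a
  map_smul' c x := by simp [mul_assoc]

@[simp]
theorem lmul_apply (a x : A) : lmul a x = a * x := rfl

/-- The map of right modules sending `1` to `z`. -/
def pmul {ι : Type*} (z : ι → A) : A →ₗ[Aᵐᵒᵖ] (ι → A) := LinearMap.pi fun i => lmul (z i)

/-- Maps out of a free right module multiply entries on the left. This is why kernels of such maps
are insensitive to what paths look like at their right end. -/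
theorem pi_linearMap_apply {ι : Type*} [Fintype ι] [DecidableEq ι] (f : (ι → A) →ₗ[Aᵐᵒᵖ] A)
    (z : ι → A) : f z = ∑ i, f (Pi.single i 1) * z i := by
  have h : z = ∑ i, (Pi.single i (1 : A) : ι → A) <• z i := by
    ext j
    simp [Finset.sum_apply, Pi.single_apply]
  conv_lhs => rw [h]
  simp

theorem projective_range_lmul_of_isIdempotent {e : A} (he : e * e = e) :
    Module.Projective Aᵐᵒᵖ (LinearMap.range (lmul e)) := by
  refine Module.Projective.of_split (LinearMap.range (lmul e)).subtype (lmul e).rangeRestrict ?_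
  ext ⟨_, x, rfl⟩
  simp [← mul_assoc, he]

end LeftMultiplication

section Arrow

/-- The path ends with the given arrow. -/
def EndsWith {V : Type v} [Quiver.{w} V] {s t : V} (β : s ⟶ t) (p : AnyPath V) : Prop :=
  ∃ (a : V) (q : Path a s), p = ⟨a, t, q.cons β⟩

theorem endsWith_cons {V : Type v} [Quiver.{w} V] {a s t s' t' : V} {β : s ⟶ t} {q : Path a s'}
    {α : s' ⟶ t'} :
    EndsWith β ⟨a, t', q.cons α⟩ ↔ (⟨s', t', α⟩ : Σ x y : V, x ⟶ y) = ⟨s, t, β⟩ := by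
  constructor
  · rintro ⟨c, r, h⟩
    obtain ⟨rfl, h⟩ := Sigma.mk.inj_iff.mp h
    obtain ⟨rfl, h⟩ := Sigma.mk.inj_iff.mp (eq_of_heq h)
    obtain ⟨rfl, -, h⟩ := Path.cons.inj (eq_of_heq h)
    rw [eq_of_heq h]
  · intro h
    obtain ⟨rfl, h⟩ := Sigma.mk.inj_iff.mp h
    obtain ⟨rfl, h⟩ := Sigma.mk.inj_iff.mp (eq_of_heq h)
    obtain rfl := eq_of_heq h
    exact ⟨a, q, rfl⟩

end Arrow

/-! ### Units in corner rings and projections onto sets of paths -/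

namespace PathPresentation

variable {k : Type u} {V : Type v} {A : Type u'} [Field k] [Quiver.{w} V] [Fintype V]
  [Ring A] [Algebra k A] (B : PathPresentation k V A)

/-- The right module `pA`. -/
abbrev pathModule {a b : V} (p : Path a b) : Submodule Aᵐᵒᵖ A := LinearMap.range (lmul (B.elt p))

instance (a : V) : Module.Projective Aᵐᵒᵖ (B.pathModule (Path.nil : Path a a)) :=
  projective_range_lmul_of_isIdempotent (B.elt_nil_mul _)

variable {B} in
/-- An element of the corner ring at a vertex with invertible leading coefficient is induced by a
unit. -/
theorem BoundedBy.exists_isUnit {N : ℕ} (hN : B.BoundedBy N) {a : A} {v : V}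
    (h : B.coef a ⟨v, v, Path.nil⟩ ≠ 0) :
    ∃ U : A, IsUnit U ∧
      B.elt (Path.nil : Path v v) * U =
        B.elt (Path.nil : Path v v) * a * B.elt (Path.nil : Path v v) ∧
      U * B.elt (Path.nil : Path v v) =
        B.elt (Path.nil : Path v v) * a * B.elt (Path.nil : Path v v) := by
  set e := B.elt (Path.nil : Path v v) with he
  have hee : e * e = e := B.elt_nil_mul _
  set c := B.coef a ⟨v, v, Path.nil⟩ with hc
  -- On the corner `eAe` the unit agrees with `eae`, and on the complement of `e` it is the scalar
  -- `c`. Subtracting `c • e` removes the only trivial path, so the second summand is nilpotent.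
  refine ⟨algebraMap k A c + (e * a * e - c • e), hN.isUnit_add h fun u => ?_, ?_, ?_⟩
  · by_cases hu : v = u
    · subst hu
      rw [map_sub, map_smul, Finsupp.sub_apply, Finsupp.smul_apply,
        B.coef_elt_self _ (B.elt_ne_zero h), he, mul_assoc, B.coef_nil_mul, B.coef_mul_nil, ← hc]
      simp
    · rw [map_sub, map_smul, Finsupp.sub_apply, Finsupp.smul_apply, B.coef_elt_ne, he, mul_assoc,
        B.coef_nil_mul_of_ne _ _ hu]
      · simp
      · intro h'
        exact hu (Sigma.mk.inj_iff.mp h').1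
  · rw [Algebra.algebraMap_eq_smul_one, mul_add, mul_sub, mul_smul_comm, mul_smul_comm, mul_one,
      ← mul_assoc, ← mul_assoc, hee]
    abel
  · rw [Algebra.algebraMap_eq_smul_one, add_mul, sub_mul, smul_mul_assoc, smul_mul_assoc, one_mul,
      mul_assoc _ e e, hee]
    abel

/-- The nonzero coefficient at the trivial path makes `e_v · g(m) · e_v` invertible in its corner,
so `G` maps onto the projective module `e_v A`. The map splits, and indecomposability leaves no room
for a kernel. -/
theorem nonempty_linearEquiv_pathModule_nil {N : ℕ} (hN : B.BoundedBy N)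
    {G : Type u'} [AddCommGroup G] [Module Aᵐᵒᵖ G] (hG : IsIndecomposable A G)
    (g : G →ₗ[Aᵐᵒᵖ] A) (m : G) {v : V} (h : B.coef (g m) ⟨v, v, Path.nil⟩ ≠ 0) :
    Nonempty (G ≃ₗ[Aᵐᵒᵖ] B.pathModule (Path.nil : Path v v)) := by
  obtain ⟨U, ⟨U, rfl⟩, hU, -⟩ := hN.exists_isUnit h
  let f : G →ₗ[Aᵐᵒᵖ] B.pathModule (Path.nil : Path v v) :=
    (lmul (B.elt (Path.nil : Path v v))).rangeRestrict ∘ₗ g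
  have hf : Function.Surjective f := by
    rintro ⟨_, y, rfl⟩
    refine ⟨m <• (B.elt (Path.nil : Path v v) * (↑U⁻¹ * y)), Subtype.ext ?_⟩
    change B.elt (Path.nil : Path v v) *
      g (m <• (B.elt (Path.nil : Path v v) * (↑U⁻¹ * y))) = B.elt (Path.nil : Path v v) * y
    rw [map_smul, MulOpposite.smul_eq_mul_unop, MulOpposite.unop_op, ← mul_assoc, ← mul_assoc,
      ← hU, mul_assoc, ← mul_assoc (U : A), Units.mul_inv, one_mul]
  obtain ⟨s, hs⟩ := Module.projective_lifting_property f LinearMap.id hf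
  have hs' (x) : f (s x) = x := LinearMap.congr_fun hs x
  have hcompl : IsCompl (LinearMap.ker f) (LinearMap.range s) := by
    constructor
    · rw [Submodule.disjoint_def]
      rintro _ hx ⟨y, rfl⟩
      rw [LinearMap.mem_ker, hs'] at hx
      rw [hx, map_zero]
    · rw [codisjoint_iff, eq_top_iff]
      intro x _
      rw [← sub_add_cancel x (s (f x))]
      exact Submodule.add_mem_sup (by simp [hs']) ⟨_, rfl⟩
  rcases hG.2 _ _ hcompl with h1 | h1
  · exact ⟨LinearEquiv.ofBijective f ⟨LinearMap.ker_eq_bot.mp h1, hf⟩⟩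
  · exfalso
    refine B.elt_ne_zero h ?_
    have h2 : s ⟨B.elt (Path.nil : Path v v), 1, by simp⟩ = 0 :=
      (Submodule.mem_bot _).mp (h1 ▸ LinearMap.mem_range_self s _)
    have h3 := hs' ⟨B.elt (Path.nil : Path v v), 1, by simp⟩
    rw [h2, map_zero] at h3
    exact (congrArg Subtype.val h3).symm

open Classical in
/-- The projection of the algebra onto the span of the paths satisfying a predicate. -/
noncomputable def proj (P : AnyPath V → Prop) : A →ₗ[k] A :=
  (Finsupp.linearCombination k fun p : AnyPath V => if P p then B.elt p.2.2 else 0) ∘ₗ B.coef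

open Classical in
theorem proj_elt (P : AnyPath V → Prop) {a b : V} (p : Path a b) :
    B.proj P (B.elt p) = if P ⟨a, b, p⟩ then B.elt p else 0 := by
  by_cases hp : B.elt p = 0
  · simp [hp]
  · simp [proj, B.coef_elt p hp]

open Classical in
theorem coef_proj (P : AnyPath V → Prop) (x : A) (p : AnyPath V) :
    B.coef (B.proj P x) p = if P p then B.coef x p else 0 := by
  induction x using B.induction with
  | zero => simp
  | add x y hx hy => rw [map_add, map_add, map_add, Finsupp.add_apply, hx, hy]; split_ifs <;> simp
  | smul r x hx => rw [map_smul, map_smul, map_smul, Finsupp.smul_apply, hx]; split_ifs <;> simp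
  | @path a b q hq =>
    rw [B.proj_elt]
    by_cases h : (⟨a, b, q⟩ : AnyPath V) = p
    · subst h
      split_ifs <;> simp
    · rw [B.coef_elt_ne _ _ h]
      split_ifs <;> simp [B.coef_elt_ne _ _ h]

/-- Left multiplication prolongs a path at its start and leaves its last arrow alone. A trivial path
has no last arrow to preserve, hence the restriction to `B.layer 1`. -/
theorem proj_endsWith_mul {s t : V} (β : s ⟶ t) (b : A) {z : A} (hz : z ∈ B.layer 1) :
    B.proj (EndsWith β) (b * z) = b * B.proj (EndsWith β) z := by
  induction b using B.induction with
  | zero => simp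
  | add x y hx hy => simp [add_mul, hx, hy]
  | smul r x hx => simp [hx]
  | @path c d q hq =>
  induction hz using Submodule.span_induction with
  | zero => simp
  | add x y _ _ hx hy => simp [mul_add, hx, hy]
  | smul r x _ hx => simp [hx]
  | mem x hx =>
    obtain ⟨a, b', p, hp, rfl⟩ := hx
    cases p with
    | nil => simp at hp
    | @cons b _ p α =>
      rw [B.proj_elt]
      by_cases h : d = a
      · subst h
        rw [B.elt_mul_elt, B.proj_elt, Path.comp_cons]
        have e : EndsWith β ⟨c, b', (q.comp p).cons α⟩ ↔ EndsWith β ⟨d, b', p.cons α⟩ := by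
          rw [endsWith_cons, endsWith_cons]
        by_cases h : EndsWith β ⟨d, b', p.cons α⟩
        · rw [if_pos h, if_pos (e.mpr h), B.elt_mul_elt, Path.comp_cons]
        · rw [if_neg h, if_neg (mt e.mp h), mul_zero]
      · rw [B.elt_mul_elt_of_ne _ _ h]
        split_ifs
        · simp [B.elt_mul_elt_of_ne _ _ h]
        · simp

end PathPresentation

/-! ### String conditions and the shift along a path -/

namespace PathPresentation

variable {k : Type u} {V : Type v} {A : Type u'} [Field k] [Quiver.{w} V] [Fintype V]
  [Ring A] [Algebra k A] (B : PathPresentation k V A)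

/-- The conditions on a monomial presentation that come from a string quiver. -/
structure IsString : Prop where
  unique_right : ∀ {x y z z' : V} (α : x ⟶ y) (β : y ⟶ z) (β' : y ⟶ z'),
    B.elt (α.toPath.comp β.toPath) ≠ 0 → B.elt (α.toPath.comp β'.toPath) ≠ 0 →
      (⟨z, β⟩ : Σ z : V, y ⟶ z) = ⟨z', β'⟩
  unique_left : ∀ {x y z z' : V} (α : x ⟶ y) (β : z ⟶ x) (β' : z' ⟶ x),
    B.elt (β.toPath.comp α.toPath) ≠ 0 → B.elt (β'.toPath.comp α.toPath) ≠ 0 →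
      (⟨z, β⟩ : Σ z : V, z ⟶ x) = ⟨z', β'⟩
  finite_paths : {p : AnyPath V | B.elt p.2.2 ≠ 0}.Finite

variable {B} in
theorem IsString.exists_boundedBy (hB : B.IsString) : ∃ N, B.BoundedBy N := by
  obtain ⟨N, hN⟩ := (hB.finite_paths.image fun p : AnyPath V => p.2.2.length).bddAbove
  refine ⟨N + 1, fun {a b} p hp => ?_⟩
  by_contra h
  have := hN ⟨⟨a, b, p⟩, h, rfl⟩
  simp at this
  omega

variable {B} in
theorem IsString.finite (hB : B.IsString) : Module.Finite k A := by
  refine ⟨⟨(hB.finite_paths.image fun p : AnyPath V => B.elt p.2.2).toFinset, ?_⟩⟩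
  rw [Set.Finite.coe_toFinset, eq_top_iff]
  intro x _
  exact B.mem_of_coef _ fun {a b} p hp => Submodule.subset_span ⟨⟨a, b, p⟩, B.elt_ne_zero hp, rfl⟩

variable {B} in
/-- A nonzero path beginning with a given arrow has at most one continuation by an arrow. -/
theorem IsString.unique_extension (hB : B.IsString) {s t c d d' : V} {β : s ⟶ t} {x : Path t c}
    {γ : c ⟶ d} {δ : c ⟶ d'} (hγ : B.elt ((β.toPath.comp x).cons γ) ≠ 0)
    (hδ : B.elt ((β.toPath.comp x).cons δ) ≠ 0) : (⟨d, γ⟩ : Σ d : V, c ⟶ d) = ⟨d', δ⟩ := by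
  cases x with
  | nil => exact hB.unique_right β γ δ hγ hδ
  | @cons c' _ x α =>
    refine hB.unique_right α γ δ (B.elt_ne_zero_right (p := β.toPath.comp x) ?_)
      (B.elt_ne_zero_right (p := β.toPath.comp x) ?_)
    · exact hγ
    · exact hδ

variable {B} in
/-- Nonzero paths ending with the same arrow are suffixes of one another. -/
theorem IsString.exists_eq_comp (hB : B.IsString) {a a' s t : V} {β : s ⟶ t} {p : Path a s}
    {q : Path a' s} (hp : B.elt (p.cons β) ≠ 0) (hq : B.elt (q.cons β) ≠ 0)
    (h : p.length ≤ q.length) : ∃ r : Path a' a, q = r.comp p := by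
  induction p generalizing t with
  | nil => exact ⟨q, rfl⟩
  | @cons b c p α ih =>
    cases q with
    | nil => simp at h
    | @cons b' _ q α' =>
      have e := hB.unique_left β α α' (B.elt_ne_zero_right (p := p) hp)
        (B.elt_ne_zero_right (p := q) hq)
      obtain ⟨rfl, e⟩ := Sigma.mk.inj_iff.mp e
      obtain rfl := eq_of_heq e
      obtain ⟨r, rfl⟩ := ih (B.elt_ne_zero_left (q := β.toPath) hp)
        (B.elt_ne_zero_left (q := β.toPath) hq) (by simpa using h)
      exact ⟨r, rfl⟩

variable {ι : Type}

variable (k) in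
/-- Coordinatewise right multiplication. -/
def rmul (a : A) : (ι → A) →ₗ[k] (ι → A) :=
  LinearMap.pi fun i => LinearMap.mulRight k a ∘ₗ LinearMap.proj i

theorem rmul_apply (a : A) (z : ι → A) : rmul k a z = z <• a := rfl

theorem smul_op_smul (c : k) (z : ι → A) (a : A) : (c • z) <• a = c • (z <• a) := by
  ext i
  simp

theorem op_smul_op_smul (z : ι → A) (a b : A) : (z <• a) <• b = z <• (a * b) := by
  ext i
  simp [mul_assoc]

/-- The sum of `φ (y v) • z u` over all decompositions `x = u v` of a path. -/
noncomputable def shiftSum (z : ι → A) {t : V} :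
    ∀ {t' : V}, Path t t' → ((ι → A) →ₗ[k] k) → (ι → A) → (ι → A)
  | _, Path.nil, φ, y =>
    φ (y <• B.elt (Path.nil : Path t t)) • (z <• B.elt (Path.nil : Path t t))
  | _, Path.cons (c := c) x γ, φ, y =>
    φ (y <• B.elt (Path.nil : Path c c)) • (z <• B.elt (x.cons γ)) +
      shiftSum z x (φ ∘ₗ rmul k (B.elt γ.toPath)) y

theorem shiftSum_add (z : ι → A) {t t' : V} (x : Path t t') (φ : (ι → A) →ₗ[k] k) (y y' : ι → A) :
    B.shiftSum z x φ (y + y') = B.shiftSum z x φ y + B.shiftSum z x φ y' := by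
  induction x generalizing φ with
  | nil => simp [shiftSum, add_smul]
  | cons x γ ih => simp only [shiftSum, smul_add, map_add, add_smul, ih]; abel

theorem shiftSum_smul (z : ι → A) {t t' : V} (x : Path t t') (φ : (ι → A) →ₗ[k] k) (c : k)
    (y : ι → A) : B.shiftSum z x φ (c • y) = c • B.shiftSum z x φ y := by
  induction x generalizing φ with
  | nil => simp only [shiftSum, smul_op_smul, map_smul, smul_assoc]
  | cons x γ ih => simp only [shiftSum, smul_op_smul, map_smul, smul_assoc, ih, smul_add]

theorem exists_shiftSum_eq (z : ι → A) {t t' : V} (x : Path t t') (φ : (ι → A) →ₗ[k] k)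
    (y : ι → A) : ∃ a : A, B.shiftSum z x φ y = z <• a := by
  induction x generalizing φ with
  | nil =>
    refine ⟨φ (y <• B.elt (Path.nil : Path t t)) • B.elt (Path.nil : Path t t), ?_⟩
    ext i
    simp [shiftSum]
  | @cons b c x γ ih =>
    obtain ⟨a, ha⟩ := ih (φ ∘ₗ rmul k (B.elt γ.toPath))
    refine ⟨φ (y <• B.elt (Path.nil : Path c c)) • B.elt (x.cons γ) + a, ?_⟩
    ext i
    simp [shiftSum, ha, mul_add]

theorem shiftSum_eq_zero (z : ι → A) {t t' : V} (x : Path t t') (φ : (ι → A) →ₗ[k] k)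
    (y : ι → A) (h : ∀ {b : V} (q : Path b t'), φ (y <• B.elt q) = 0) :
    B.shiftSum z x φ y = 0 := by
  induction x generalizing φ with
  | nil => simp [shiftSum, h]
  | @cons b c x γ ih =>
    rw [shiftSum, h, zero_smul, zero_add]
    refine ih _ fun q => ?_
    have := h (q.cons γ)
    rwa [B.elt_cons, ← op_smul_op_smul] at this

theorem shiftSum_op_smul_nil (z : ι → A) {t t' : V} (x : Path t t') (φ : (ι → A) →ₗ[k] k)
    (y : ι → A) (a : V) :
    B.shiftSum z x φ (y <• B.elt (Path.nil : Path a a)) =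
      (B.shiftSum z x φ y) <• B.elt (Path.nil : Path a a) := by
  have key {c : V} (q : Path t c) (φ : (ι → A) →ₗ[k] k) :
      φ ((y <• B.elt (Path.nil : Path a a)) <• B.elt (Path.nil : Path c c)) • (z <• B.elt q) =
        (φ (y <• B.elt (Path.nil : Path c c)) • (z <• B.elt q)) <•
          B.elt (Path.nil : Path a a) := by
    rw [smul_op_smul, op_smul_op_smul, op_smul_op_smul]
    by_cases h : a = c
    · subst h
      rw [B.elt_mul_nil, B.elt_mul_nil]
    · rw [B.elt_mul_elt_of_ne _ _ h, B.elt_mul_elt_of_ne _ _ (Ne.symm h)]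
      simp
  induction x generalizing φ with
  | nil => exact key _ _
  | @cons b c x γ ih => rw [shiftSum, shiftSum, smul_add, ← ih, key]

/-- The form `φ` is only supported on the last arrow of `x`. -/
def FormSupported {t t' : V} (x : Path t t') (φ : (ι → A) →ₗ[k] k) : Prop :=
  ∀ {s : V} (x' : Path t s) (γ : s ⟶ t'), x = x'.cons γ → ∀ {a b : V} (δ : a ⟶ b) (y : ι → A),
    φ (y <• B.elt δ.toPath) ≠ 0 → (⟨a, b, δ⟩ : Σ a b : V, a ⟶ b) = ⟨s, t', γ⟩

/-- Right multiples of `z` by paths have at most one continuation by an arrow. -/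
def UniqueContinuation (z : ι → A) (t : V) : Prop :=
  ∀ {c d d' : V} (x : Path t c) (γ : c ⟶ d) (δ : c ⟶ d'),
    z <• B.elt (x.cons γ) ≠ 0 → z <• B.elt (x.cons δ) ≠ 0 → (⟨d, γ⟩ : Σ d : V, c ⟶ d) = ⟨d', δ⟩

-- The failure of the shift to commute with an arrow telescopes: passing `δ` across moves the cut in
-- `x = uv` by one arrow, so only the two end terms, containing `zxδ` and `yδx`, survive. The string
-- conditions ensure that `δ` is the arrow being crossed whenever a term is nonzero.
variable {B} in
theorem IsString.shiftSum_op_smul_arrow (hB : B.IsString) {z : ι → A} {t t' : V} {x : Path t t'}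
    {φ : (ι → A) →ₗ[k] k} (hφ : B.FormSupported x φ) (hz : B.UniqueContinuation z t)
    (hx : z <• B.elt x ≠ 0) {a b : V} (δ : a ⟶ b) (y : ι → A) :
    B.shiftSum z x φ (y <• B.elt δ.toPath) +
        φ (y <• B.elt (Path.nil : Path t' t')) • (z <• (B.elt x * B.elt δ.toPath)) =
      (B.shiftSum z x φ y) <• B.elt δ.toPath +
        φ (y <• (B.elt δ.toPath * B.elt x)) • (z <• B.elt (Path.nil : Path t t)) := by
  induction x generalizing φ with
  | nil =>
    rw [shiftSum, shiftSum, op_smul_op_smul, smul_op_smul, op_smul_op_smul]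
    abel
  | @cons s t' x γ ih =>
    have hx' : z <• B.elt x ≠ 0 := by
      intro h
      rw [B.elt_cons, ← op_smul_op_smul, h, smul_zero] at hx
      exact hx rfl
    -- Both the arrow seen by the new form and the last arrow of `x` have nonzero product with `γ`,
    -- so `unique_left` identifies them.
    have hφ' : B.FormSupported x (φ ∘ₗ rmul k (B.elt γ.toPath)) := by
      rintro s' x' γ' rfl a' b' δ' y' hy'
      have h1 : B.elt δ'.toPath * B.elt γ.toPath ≠ 0 := by
        intro h
        rw [LinearMap.comp_apply, rmul_apply, op_smul_op_smul, h] at hy'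
        simp at hy'
      have h2 : B.elt (γ'.toPath.comp γ.toPath) ≠ 0 := by
        intro h
        have : B.elt ((x'.cons γ').cons γ) = 0 := by
          rw [show (x'.cons γ').cons γ = x'.comp (γ'.toPath.comp γ.toPath) from rfl,
            ← B.elt_mul_elt, h, mul_zero]
        rw [this] at hx
        simp at hx
      have hb : b' = s := by
        by_contra hb
        exact h1 (B.elt_mul_elt_of_ne _ _ hb)
      subst hb
      rw [B.elt_mul_elt] at h1
      have e := hB.unique_left γ δ' γ' h1 h2
      obtain ⟨rfl, e⟩ := Sigma.mk.inj_iff.mp e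
      rw [eq_of_heq e]
    have ih' := ih hφ' hx'
    simp only [LinearMap.comp_apply, rmul_apply, op_smul_op_smul, B.elt_nil_mul, mul_assoc,
      ← B.elt_cons] at ih'
    -- The two sides agree for `δ = γ`. For other arrows the left side vanishes by the support of
    -- `φ`, and the right side by uniqueness of the continuation of `z`.
    have key : φ (y <• (B.elt δ.toPath * B.elt (Path.nil : Path t' t'))) • (z <• B.elt (x.cons γ)) =
        φ (y <• B.elt γ.toPath) • (z <• (B.elt x * B.elt δ.toPath)) := by
      by_cases e : (⟨a, b, δ⟩ : Σ a b : V, a ⟶ b) = ⟨s, t', γ⟩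
      · obtain ⟨rfl, e⟩ := Sigma.mk.inj_iff.mp e
        obtain ⟨rfl, e⟩ := Sigma.mk.inj_iff.mp (eq_of_heq e)
        obtain rfl := eq_of_heq e
        rw [B.elt_mul_nil, B.elt_cons]
      · have h1 : φ (y <• (B.elt δ.toPath * B.elt (Path.nil : Path t' t'))) = 0 := by
          by_cases hb : b = t'
          · subst hb
            rw [B.elt_mul_nil]
            by_contra h
            exact e (hφ x γ rfl δ y h)
          · rw [B.elt_mul_elt_of_ne _ _ hb]
            simp
        have h2 : z <• (B.elt x * B.elt δ.toPath) = 0 := by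
          by_cases ha : a = s
          · subst ha
            by_contra h
            rw [← B.elt_cons] at h
            have e' := hz x γ δ hx h
            obtain ⟨rfl, e'⟩ := Sigma.mk.inj_iff.mp e'
            exact e (by rw [eq_of_heq e'])
          · rw [B.elt_mul_elt_of_ne _ _ (Ne.symm ha)]
            simp
        rw [h1, h2, zero_smul, smul_zero]
    simp only [shiftSum, smul_add, op_smul_op_smul, smul_op_smul]
    rw [key]
    rw [add_assoc, add_assoc, ← ih']
    abel
end PathPresentation

/-! ### Fitting's lemma for indecomposable modules -/

section Fitting

variable {A : Type u'} [Ring A] {G : Type u'} [AddCommGroup G] [Module Aᵐᵒᵖ G]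

/-- An endomorphism of an indecomposable module of finite length with a nonzero fixed vector is
surjective. -/
theorem IsIndecomposable.surjective_of_fixed [IsNoetherian Aᵐᵒᵖ G] [IsArtinian Aᵐᵒᵖ G]
    (hG : IsIndecomposable A G) (r : G →ₗ[Aᵐᵒᵖ] G) {x : G} (hx : x ≠ 0) (hr : r x = x) :
    Function.Surjective r := by
  rcases hG.2 _ _ (LinearMap.isCompl_iSup_ker_pow_iInf_range_pow r) with h | h
  · apply IsArtinian.surjective_of_injective_endomorphism
    rw [← LinearMap.ker_eq_bot, eq_bot_iff, ← h]
    exact le_iSup_of_le 1 (by simp)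
  · refine absurd ?_ hx
    rw [← Submodule.mem_bot Aᵐᵒᵖ, ← h, Submodule.mem_iInf]
    intro n
    refine ⟨x, ?_⟩
    induction n with
    | zero => simp
    | succ n ih => rw [pow_succ, Module.End.mul_apply, hr, ih]

end Fitting

/-! ### Cyclicity of indecomposable kernels -/

namespace PathPresentation

variable {k : Type u} {V : Type v} {A : Type u'} [Field k] [Quiver.{w} V] [Fintype V]
  [Ring A] [Algebra k A] {B : PathPresentation k V A} {ι : Type}

theorem coef_op_smul_ne_zero {z : ι → A} {c d : V} {x : Path c d} (h : z <• B.elt x ≠ 0) :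
    ∃ (i : ι) (a : V) (w : Path a c), B.coef (z i) ⟨a, c, w⟩ ≠ 0 ∧
      B.coef ((z <• B.elt x) i) ⟨a, d, w.comp x⟩ ≠ 0 := by
  obtain ⟨i, hi⟩ := Function.ne_iff.mp h
  obtain ⟨a, b, p, hp⟩ := B.exists_coef_ne_zero hi
  obtain ⟨w, e, hw⟩ := B.exists_eq_comp_of_coef_mul_elt (z i) x p hp
  refine ⟨i, a, w, hw, ?_⟩
  rw [← e]
  exact hp

/-- If `x` is a longest path with `z x ≠ 0` for some `z` in an indecomposable submodule of a free
module of finite length, and `z` has unique continuations, then `z` generates. -/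
theorem IsString.range_pmul_eq (hB : B.IsString) (K : Submodule Aᵐᵒᵖ (ι → A))
    [IsNoetherian Aᵐᵒᵖ K] [IsArtinian Aᵐᵒᵖ K] (hK : IsIndecomposable A K)
    {z : ι → A} (hzK : z ∈ K) {t t' : V} {x : Path t t'} (hz : B.UniqueContinuation z t)
    (hx : z <• B.elt x ≠ 0)
    (hmax : ∀ y ∈ K, ∀ {a b : V} (q : Path a b), x.length < q.length → y <• B.elt q = 0) :
    LinearMap.range (pmul z) = K := by
  obtain ⟨i, a, w, -, hw⟩ := coef_op_smul_ne_zero hx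
  -- A coefficient functional reading off one path `wx` that occurs in `zx`, normalised to take the
  -- value one there. Since that path ends with `x`, the functional sees only the last arrow of `x`.
  let φ : (ι → A) →ₗ[k] k := (B.coef ((z <• B.elt x) i) ⟨a, t', w.comp x⟩)⁻¹ •
    (Finsupp.lapply (⟨a, t', w.comp x⟩ : AnyPath V) ∘ₗ B.coef ∘ₗ LinearMap.proj i)
  have hφ1 : φ (z <• B.elt x) = 1 := inv_mul_cancel₀ hw
  have hφ : B.FormSupported x φ := by
    rintro s x' γ rfl c d δ y hy
    have hy' : B.coef (y i * B.elt δ.toPath) ⟨a, t', w.comp (x'.cons γ)⟩ ≠ 0 := by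
      intro h
      exact hy ((congrArg _ h).trans (mul_zero _))
    obtain ⟨u, e, -⟩ := B.exists_eq_comp_of_coef_mul_elt _ _ _ hy'
    exact (endsWith_cons.mp ⟨a, u, e⟩).symm
  have hmem : ∀ y, B.shiftSum z x φ y ∈ LinearMap.range (pmul z) := fun y => by
    obtain ⟨c, hc⟩ := B.exists_shiftSum_eq z x φ y
    exact ⟨c, hc.symm⟩
  have hle : LinearMap.range (pmul z) ≤ K := by
    rintro _ ⟨c, rfl⟩
    exact K.smul_mem _ hzK
  have harrow (y) (hy : y ∈ K) {c d : V} (δ : c ⟶ d) :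
      B.shiftSum z x φ (y <• B.elt δ.toPath) = (B.shiftSum z x φ y) <• B.elt δ.toPath := by
    have h := hB.shiftSum_op_smul_arrow hφ hz hx δ y
    -- Both end terms of the commutation formula contain a path longer than `x` acting on an element
    -- of `K`, so the maximality of `x` kills them.
    have h1 : z <• (B.elt x * B.elt δ.toPath) = 0 := by
      by_cases hc : t' = c
      · subst hc
        rw [← B.elt_cons]
        exact hmax z hzK _ (by simp)
      · rw [B.elt_mul_elt_of_ne _ _ hc]
        simp
    have h2 : y <• (B.elt δ.toPath * B.elt x) = 0 := by
      by_cases hd : d = t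
      · subst hd
        rw [B.elt_mul_elt]
        exact hmax y hy _ (by simp [Path.length_comp])
      · rw [B.elt_mul_elt_of_ne _ _ hd]
        simp
    rwa [h1, h2, map_zero, smul_zero, add_zero, zero_smul, add_zero] at h
  have hsmul (y) (hy : y ∈ K) (a : A) :
      B.shiftSum z x φ (y <• a) = (B.shiftSum z x φ y) <• a := by
    induction a using B.induction with
    | zero =>
      have := B.shiftSum_smul z x φ 0 y
      simpa using this
    | add a b ha hb => rw [MulOpposite.op_add, add_smul, add_smul, B.shiftSum_add, ha, hb]
    | smul c a ha =>
      have e (y : ι → A) : y <• (c • a) = c • (y <• a) := by ext j; simp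
      rw [e, e, B.shiftSum_smul, ha]
    | @path c d p _ =>
      induction p with
      | nil => exact B.shiftSum_op_smul_nil z x φ y c
      | cons p δ ih =>
        by_cases hp : B.elt p = 0
        · rw [B.elt_cons, hp]
          have := B.shiftSum_smul z x φ 0 y
          simpa using this
        · rw [B.elt_cons, ← op_smul_op_smul, ← op_smul_op_smul, harrow _ (K.smul_mem _ hy), ih hp]
  let r : K →ₗ[Aᵐᵒᵖ] K :=
    { toFun := fun y => ⟨B.shiftSum z x φ y, hle (hmem y)⟩
      map_add' := fun y y' => Subtype.ext (B.shiftSum_add z x φ y y')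
      map_smul' := fun a y => Subtype.ext (hsmul y y.2 a.unop) }
  have hfix : B.shiftSum z x φ (z <• B.elt x) = z <• B.elt x := by
    have hzx : (z <• B.elt x) <• B.elt (Path.nil : Path t' t') = z <• B.elt x := by
      rw [op_smul_op_smul, B.elt_mul_nil]
    cases x with
    | nil => rw [shiftSum, hzx, hφ1, one_smul]
    | @cons s _ x γ =>
      -- Only the decomposition with trivial second factor contributes; every other one multiplies
      -- `zx` by a nontrivial path.
      rw [shiftSum, hzx, hφ1, one_smul, B.shiftSum_eq_zero, add_zero]
      intro b q
      rw [LinearMap.comp_apply, rmul_apply, op_smul_op_smul, op_smul_op_smul]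
      have : z <• (B.elt (x.cons γ) * (B.elt q * B.elt γ.toPath)) = 0 := by
        rw [← B.elt_cons]
        by_cases hb : t' = b
        · subst hb
          rw [B.elt_mul_elt]
          exact hmax z hzK _ (by simp [Path.length_comp])
        · rw [B.elt_mul_elt_of_ne _ _ hb]
          simp
      rw [this, map_zero]
  refine le_antisymm hle fun y hy => ?_
  obtain ⟨y', hy'⟩ := hK.surjective_of_fixed r (x := ⟨z <• B.elt x, K.smul_mem _ hzK⟩)
    (fun h => hx (congrArg Subtype.val h)) (Subtype.ext hfix) ⟨y, hy⟩
  rw [← show B.shiftSum z x φ y' = y from congrArg Subtype.val hy']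
  exact hmem y'

theorem nonempty_linearEquiv_range {A : Type u'} [Ring A] {M M' : Type u'} [AddCommGroup M]
    [Module Aᵐᵒᵖ M] [AddCommGroup M'] [Module Aᵐᵒᵖ M'] (f : A →ₗ[Aᵐᵒᵖ] M) (g : A →ₗ[Aᵐᵒᵖ] M')
    (h : ∀ y, f y = 0 ↔ g y = 0) :
    Nonempty (LinearMap.range f ≃ₗ[Aᵐᵒᵖ] LinearMap.range g) := by
  have e : LinearMap.ker f = LinearMap.ker g := by
    ext y
    exact h y
  exact ⟨f.quotKerEquivRange.symm ≪≫ₗ Submodule.quotEquivOfEq _ _ e ≪≫ₗ g.quotKerEquivRange⟩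

/-- A nonzero vector all of whose entries are combinations of paths ending with a given arrow
generates a module isomorphic to one generated by a path. -/
theorem IsString.exists_range_pmul_equiv (hB : B.IsString) {z : ι → A} (hz0 : z ≠ 0) {s t : V}
    (β : s ⟶ t)
    (hz : ∀ i {a b : V} (p : Path a b), B.coef (z i) ⟨a, b, p⟩ ≠ 0 → EndsWith β ⟨a, b, p⟩) :
    ∃ (a : V) (p : Path a t), B.elt p ≠ 0 ∧
      Nonempty (LinearMap.range (pmul z) ≃ₗ[Aᵐᵒᵖ] B.pathModule p) := by
  classical
  obtain ⟨N, hN⟩ := hB.exists_boundedBy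
  have hex : ∃ n, ∃ (i : ι) (a : V) (p : Path a s), p.length = n ∧
      B.coef (z i) ⟨a, t, p.cons β⟩ ≠ 0 := by
    obtain ⟨i, hi⟩ := Function.ne_iff.mp hz0
    obtain ⟨a, b, p, hp⟩ := B.exists_coef_ne_zero hi
    obtain ⟨a', q, e⟩ := hz i p hp
    exact ⟨_, i, a', q, rfl, e ▸ hp⟩
  -- A shortest path in the support of `z`. All paths there have last arrow `β`, so it is a suffix
  -- of each of them and right-divides every entry.
  obtain ⟨i₀, a, p, hpl, hp⟩ := Nat.find_spec hex
  have hmin : ∀ i {a' : V} (q : Path a' s), B.coef (z i) ⟨a', t, q.cons β⟩ ≠ 0 →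
      p.length ≤ q.length := fun i a' q hq => by
    rw [hpl]
    exact Nat.find_min' hex ⟨i, a', q, rfl, hq⟩
  have hdiv (i) : ∃ c, z i = c * B.elt (p.cons β) := by
    have : z i ∈ LinearMap.range (LinearMap.mulRight k (B.elt (p.cons β))) := by
      refine B.mem_of_coef _ fun {a' b'} q hq => ?_
      obtain ⟨a'', q', e⟩ := hz i q hq
      obtain ⟨rfl, e⟩ := Sigma.mk.inj_iff.mp e
      obtain ⟨rfl, e⟩ := Sigma.mk.inj_iff.mp (eq_of_heq e)
      obtain rfl := eq_of_heq e
      obtain ⟨r, rfl⟩ := hB.exists_eq_comp (B.elt_ne_zero hp) (B.elt_ne_zero hq) (hmin i q' hq)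
      exact ⟨B.elt r, B.elt_mul_elt _ _⟩
    obtain ⟨c, hc⟩ := this
    exact ⟨c, hc.symm⟩
  choose c hc using hdiv
  refine ⟨a, p.cons β, B.elt_ne_zero hp, nonempty_linearEquiv_range _ _ fun y => ⟨fun h => ?_,
    fun h => ?_⟩⟩
  · have hc0 : B.coef (c i₀) ⟨a, a, Path.nil⟩ ≠ 0 := by
      have h1 := B.coef_mul_elt (c i₀) Path.nil (p.cons β)
        (by rw [Path.nil_comp]; exact B.elt_ne_zero hp)
      rw [Path.nil_comp, ← hc] at h1
      rwa [← h1]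
    obtain ⟨_, ⟨U, rfl⟩, -, hU⟩ := hN.exists_isUnit hc0
    have h2 : z i₀ * y = 0 := congr_fun h i₀
    have h3 : (U : A) * (B.elt (p.cons β) * y) = 0 := by
      rw [← B.elt_nil_mul (p.cons β), ← mul_assoc, ← mul_assoc, hU, mul_assoc, mul_assoc,
        ← mul_assoc _ (B.elt (p.cons β)), B.elt_nil_mul,
        mul_assoc _ (c i₀), ← mul_assoc (c i₀), ← hc, h2, mul_zero]
    exact (Units.mul_right_eq_zero U).mp h3
  · ext i
    change z i * y = 0
    rw [hc, mul_assoc, show B.elt (p.cons β) * y = 0 from h, mul_zero]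

end PathPresentation

/-! ### Non-projective indecomposable summands -/

section Summand

variable {A : Type u'} [Ring A] {G : Type u'} [AddCommGroup G] [Module Aᵐᵒᵖ G]

/-- A non-projective Artinian module has an indecomposable non-projective direct summand. -/
theorem exists_indecomposable_retract [IsArtinian Aᵐᵒᵖ G] (hG : ¬ Module.Projective Aᵐᵒᵖ G) :
    ∃ (N : Submodule Aᵐᵒᵖ G) (r : G →ₗ[Aᵐᵒᵖ] N), r ∘ₗ N.subtype = LinearMap.id ∧
      IsIndecomposable A N ∧ ¬ Module.Projective Aᵐᵒᵖ N := by
  let S : Set (Submodule Aᵐᵒᵖ G) := {N | ¬ Module.Projective Aᵐᵒᵖ N ∧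
    ∃ r : G →ₗ[Aᵐᵒᵖ] N, r ∘ₗ N.subtype = LinearMap.id}
  have hS : S.Nonempty := ⟨⊤, fun h => hG (Module.Projective.of_equiv Submodule.topEquiv),
    Submodule.topEquiv.symm.toLinearMap, by ext; simp⟩
  obtain ⟨N, ⟨hN, r, hr⟩, hmin⟩ := IsArtinian.set_has_minimal S hS
  have hr' (x : N) : r x = x := LinearMap.congr_fun hr x
  -- By minimality of `N`, every summand of `N` with a nonzero complement is projective; a proper
  -- decomposition would therefore make `N` projective.
  have key : ∀ X X' : Submodule Aᵐᵒᵖ N, IsCompl X X' → X' ≠ ⊥ → Module.Projective Aᵐᵒᵖ X := by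
    intro X X' hX hX'
    have e := Submodule.equivMapOfInjective N.subtype Subtype.val_injective X
    by_contra h
    refine hmin (X.map N.subtype) ⟨fun h' => h (Module.Projective.of_equiv e.symm),
      ((Submodule.equivMapOfInjective N.subtype Subtype.val_injective X).toLinearMap ∘ₗ
        Submodule.projectionOnto X X' hX) ∘ₗ r, ?_⟩ ?_
    · ext ⟨_, x, hx, rfl⟩
      have : Submodule.projectionOnto X X' hX x = ⟨x, hx⟩ :=
        Submodule.projectionOnto_apply_left hX ⟨x, hx⟩
      simp [hr', this]
      rfl
    · refine lt_of_le_of_ne (Submodule.map_subtype_le N X) fun h1 => hX' ?_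
      have : X = ⊤ := by
        apply Submodule.map_injective_of_injective (f := N.subtype) Subtype.val_injective
        rw [h1, Submodule.map_top, Submodule.range_subtype]
      subst this
      simpa using hX.inf_eq_bot
  refine ⟨N, r, hr, ⟨?_, fun X X' hX => ?_⟩, hN⟩
  · by_contra h
    rw [not_nontrivial_iff_subsingleton] at h
    exact hN inferInstance
  · by_contra! h
    have h1 := key X X' hX h.2
    have h2 := key X' X hX.symm h.1
    exact hN (Module.Projective.of_equiv (Submodule.prodEquivOfIsCompl X X' hX))

end Summand

/-! ### Classification of indecomposable kernels -/

namespace PathPresentation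

variable {k : Type u} {V : Type v} {A : Type u'} [Field k] [Quiver.{w} V] [Fintype V]
  [Ring A] [Algebra k A] {B : PathPresentation k V A}

theorem IsString.isArtinianRing (hB : B.IsString) : IsArtinianRing Aᵐᵒᵖ := by
  have := hB.finite
  have : Module.Finite k Aᵐᵒᵖ := Module.Finite.equiv (MulOpposite.opLinearEquiv k)
  exact IsArtinianRing.of_finite k Aᵐᵒᵖ

/-- A kernel whose entries involve a trivial path is of the form `e_v A`. Otherwise some element of
it, with all its paths ending in one arrow, survives multiplication by a longest possible path and
therefore generates. -/
theorem IsString.exists_equiv_pathModule (hB : B.IsString) {G : Type u'} [AddCommGroup G]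
    [Module Aᵐᵒᵖ G] (hG : IsIndecomposable A G) (hR : IsReflexiveKernel A G) :
    ∃ (a b : V) (p : Path a b), B.elt p ≠ 0 ∧ Nonempty (G ≃ₗ[Aᵐᵒᵖ] B.pathModule p) := by
  classical
  obtain ⟨N, hN⟩ := hB.exists_boundedBy
  obtain ⟨ι, κ, _, i, f, hi, hif, -⟩ := hR
  have := Fintype.ofFinite ι
  by_cases hnil : ∃ (m : G) (j : ι) (v : V), B.coef (i m j) ⟨v, v, Path.nil⟩ ≠ 0
  · obtain ⟨m, j, v, h⟩ := hnil
    exact ⟨v, v, Path.nil, B.elt_ne_zero h,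
      B.nonempty_linearEquiv_pathModule_nil hN hG (LinearMap.proj j ∘ₗ i) m h⟩
  push Not at hnil
  set K := LinearMap.range i with hKdef
  let e : G ≃ₗ[Aᵐᵒᵖ] K := LinearEquiv.ofInjective i hi
  have hKmem (z : ι → A) : z ∈ K ↔ f z = 0 := (hif z).symm
  have hK : IsIndecomposable A K := by
    refine ⟨e.symm.toEquiv.nontrivial_congr.mpr hG.1, fun X X' hX => ?_⟩
    have h := hG.2 _ _ (hX.map (Submodule.orderIsoMapComap e.symm))
    simpa using h
  have := hB.isArtinianRing
  have : Module.Finite Aᵐᵒᵖ A := Module.Finite.equiv (opLinearEquiv A)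
  have hlayer : ∀ z ∈ K, ∀ j, z j ∈ B.layer 1 := by
    rintro _ ⟨m, rfl⟩ j
    exact B.mem_layer_one_of_coef_nil fun v => hnil m j v
  let part {s t : V} (β : s ⟶ t) (z : ι → A) : ι → A := fun j => B.proj (EndsWith β) (z j)
  -- The equations of `K` multiply entries on the left, so projecting them to paths with last arrow
  -- `β` gives the same equations for the projected entries.
  have hpart : ∀ z ∈ K, ∀ {s t : V} (β : s ⟶ t), part β z ∈ K := by
    intro z hz s t β
    rw [hKmem] at hz ⊢
    ext c
    have h1 := pi_linearMap_apply (LinearMap.proj c ∘ₗ f) (part β z)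
    have h2 := pi_linearMap_apply (LinearMap.proj c ∘ₗ f) z
    rw [show (LinearMap.proj c ∘ₗ f) z = f z c from rfl, hz] at h2
    change (LinearMap.proj c ∘ₗ f) (part β z) = 0
    rw [h1]
    have h3 := congrArg (B.proj (EndsWith β)) h2
    rw [Pi.zero_apply, map_zero, map_sum] at h3
    rw [h3]
    refine Finset.sum_congr rfl fun j _ => ?_
    exact (B.proj_endsWith_mul β _ (hlayer z ((hKmem z).mpr (by rw [hz])) j)).symm
  let L : Set ℕ := {n | ∃ z ∈ K, ∃ (a b : V) (x : Path a b), x.length = n ∧ z <• B.elt x ≠ 0}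
  have hL : L.Nonempty := by
    have := hK.1
    obtain ⟨⟨z, hzK⟩, hz⟩ := exists_ne (0 : K)
    obtain ⟨j, hj⟩ := Function.ne_iff.mp (fun h => hz (Subtype.ext h) : z ≠ 0)
    obtain ⟨a, b, p, hp⟩ := B.exists_coef_ne_zero hj
    refine ⟨_, z, hzK, b, b, Path.nil, rfl, fun h => hp ?_⟩
    rw [← B.coef_mul_nil]
    have h' : z j * B.elt (Path.nil : Path b b) = 0 := congr_fun h j
    rw [h']
    simp
  have hLb : BddAbove L := by
    refine ⟨N, ?_⟩
    rintro _ ⟨z, -, a, b, x, rfl, hx⟩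
    by_contra h
    rw [hN x (by omega)] at hx
    simp at hx
  obtain ⟨z₀, hz₀, t, t', x, hxl, hx₀⟩ := Nat.sSup_mem hL hLb
  have hmax : ∀ y ∈ K, ∀ {a b : V} (q : Path a b), x.length < q.length → y <• B.elt q = 0 := by
    intro y hy a b q hq
    by_contra h
    have := le_csSup hLb ⟨y, hy, a, b, q, rfl, h⟩
    omega
  -- The arrow `β` is the last one of a path `w` of `z₀` for which `wx` is nonzero, so the part of
  -- `z₀` ending in `β` still survives multiplication by `x`.
  obtain ⟨j, a, w, hw, hwx⟩ := coef_op_smul_ne_zero hx₀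
  cases w with
  | nil =>
    obtain ⟨m, rfl⟩ := hz₀
    exact absurd (hnil m j _) hw
  | @cons s _ w β =>
  have hz₁K := hpart z₀ hz₀ β
  have hends : ∀ i {a b : V} (p : Path a b), B.coef (part β z₀ i) ⟨a, b, p⟩ ≠ 0 →
      EndsWith β ⟨a, b, p⟩ := by
    intro i a b p hp
    by_contra h
    exact hp (by rw [B.coef_proj, if_neg h])
  have hx : part β z₀ <• B.elt x ≠ 0 := by
    intro h
    have h1 : part β z₀ j * B.elt x = 0 := congr_fun h j
    have h2 := B.elt_comp_eq_zero_of_mul_elt_eq_zero h1 (w := w.cons β)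
      (by rwa [B.coef_proj, if_pos ⟨_, _, rfl⟩])
    exact B.elt_ne_zero hwx h2
  -- Every path of this part ends in `β`, so a nonzero product with a path makes `β` followed by
  -- that path nonzero, and such a path has at most one continuation.
  have huniq : B.UniqueContinuation (part β z₀) t := by
    have key {c d : V} (x : Path t c) (γ : c ⟶ d) (h : part β z₀ <• B.elt (x.cons γ) ≠ 0) :
        B.elt ((β.toPath.comp x).cons γ) ≠ 0 := by
      obtain ⟨i, a, u, hu, hu'⟩ := coef_op_smul_ne_zero h
      obtain ⟨a', q, e⟩ := hends i u hu
      obtain ⟨rfl, e⟩ := Sigma.mk.inj_iff.mp e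
      obtain ⟨-, e⟩ := Sigma.mk.inj_iff.mp (eq_of_heq e)
      obtain rfl := eq_of_heq e
      have h1 := B.elt_ne_zero hu'
      rw [show (q.cons β).comp (x.cons γ) = q.comp ((β.toPath.comp x).cons γ) by
        rw [Path.comp_cons, Path.comp_cons, ← Path.comp_assoc]; rfl] at h1
      exact B.elt_ne_zero_right h1
    intro c d d' x γ δ hγ hδ
    exact hB.unique_extension (key x γ hγ) (key x δ hδ)
  have hrange := hB.range_pmul_eq K hK hz₁K huniq hx hmax
  obtain ⟨a, p, hp, ⟨e'⟩⟩ := hB.exists_range_pmul_equiv (z := part β z₀)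
    (fun h => hx (by rw [h, smul_zero])) β hends
  exact ⟨a, t, p, hp, ⟨e ≪≫ₗ LinearEquiv.ofEq _ _ hrange.symm ≪≫ₗ e'⟩⟩

end PathPresentation

/-! ### Syzygies of path modules and perfect pairs -/

section Extend

variable {A : Type u'} [Ring A] {Q M : Type u'} [AddCommGroup Q] [Module Aᵐᵒᵖ Q] [AddCommGroup M]
  [Module Aᵐᵒᵖ M]

theorem ExtVanish.exists_extend_ker (h : ExtVanish Aᵐᵒᵖ A M) {g : Q →ₗ[Aᵐᵒᵖ] M}
    (hg : Function.Surjective g) (φ : LinearMap.ker g →ₗ[Aᵐᵒᵖ] A) :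
    ∃ ψ : Q →ₗ[Aᵐᵒᵖ] A, ∀ x : LinearMap.ker g, ψ x = φ x := by
  obtain ⟨ψ, hψ⟩ := ExtVanish.exists_extend (f := (LinearMap.ker g).subtype)
    Subtype.val_injective (LinearMap.exact_subtype_ker_map g) hg h φ
  exact ⟨ψ, LinearMap.congr_fun hψ⟩

end Extend

section Path

theorem exists_eq_comp_of_comp_eq_comp {V : Type v} [Quiver.{w} V] {a b c d : V} {w : Path a b}
    {q : Path a c} {r : Path b d}
    {s : Path c d} (h : w.comp r = q.comp s) (hl : q.length ≤ w.length) :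
    ∃ s' : Path c b, w = q.comp s' := by
  induction r with
  | nil => exact ⟨s, h⟩
  | @cons e f r α ih =>
    cases s with
    | nil =>
      have := congrArg Path.length h
      simp only [Path.comp_cons, Path.length_cons, Path.length_comp, Path.comp_nil] at this
      omega
    | @cons e' _ s α' =>
      obtain ⟨rfl, h, -⟩ := Path.cons.inj h
      exact ih (eq_of_heq h)

/-- The path begins with `q`. -/
def StartsWith {V : Type v} [Quiver.{w} V] {b c : V} (q : Path b c) (P : AnyPath V) : Prop :=
  ∃ (d : V) (r : Path c d), P = ⟨b, d, q.comp r⟩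

end Path

namespace PathPresentation

variable {k : Type u} {V : Type v} {A : Type u'} [Field k] [Quiver.{w} V] [Fintype V]
  [Ring A] [Algebra k A] (B : PathPresentation k V A)

/-- A perfect pair, in terms of the algebra. -/
def IsPerfect {a b c : V} (p : Path a b) (q : Path b c) : Prop :=
  0 < p.length ∧ 0 < q.length ∧ B.elt p ≠ 0 ∧ B.elt q ≠ 0 ∧ B.elt (p.comp q) = 0 ∧
  (∀ (d : V) (q' : Path b d), 0 < q'.length → B.elt q' ≠ 0 →
    B.elt (p.comp q') = 0 → ∃ r : Path c d, q' = q.comp r) ∧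
  (∀ (d : V) (p' : Path d b), 0 < p'.length → B.elt p' ≠ 0 →
    B.elt (p'.comp q) = 0 → ∃ r : Path d a, p' = r.comp p)

/-- The relation of being a perfect pair, on bundled paths. -/
def PerfectRel (P Q : AnyPath V) : Prop :=
  ∃ (a b c : V) (p : Path a b) (q : Path b c), P = ⟨a, b, p⟩ ∧ Q = ⟨b, c, q⟩ ∧ B.IsPerfect p q

/-- Every linear form on `pA` is a left multiplication. -/
def FormsExtend {a b : V} (p : Path a b) : Prop :=
  ∀ φ : B.pathModule p →ₗ[Aᵐᵒᵖ] A, ∃ c : A, ∀ x, φ x = c * x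

/-- The cover of `pA` by the projective module at the end of `p`. -/
def cover {a b : V} (p : Path a b) :
    B.pathModule (Path.nil : Path b b) →ₗ[Aᵐᵒᵖ] B.pathModule p :=
  (lmul (B.elt p)).rangeRestrict ∘ₗ (B.pathModule (Path.nil : Path b b)).subtype

variable {B}

theorem nil_mul_of_mem {b : V} {x : A} (hx : x ∈ B.pathModule (Path.nil : Path b b)) :
    B.elt (Path.nil : Path b b) * x = x := by
  obtain ⟨y, rfl⟩ := hx
  rw [lmul_apply, ← mul_assoc, B.elt_nil_mul]

theorem surjective_cover {a b : V} (p : Path a b) : Function.Surjective (B.cover p) := by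
  rintro ⟨_, y, rfl⟩
  refine ⟨⟨B.elt (Path.nil : Path b b) * y, y, rfl⟩, Subtype.ext ?_⟩
  change B.elt p * (B.elt (Path.nil : Path b b) * y) = B.elt p * y
  rw [← mul_assoc, B.elt_mul_nil]

theorem pathModule_le {b c : V} (q : Path b c) :
    B.pathModule q ≤ B.pathModule (Path.nil : Path b b) := by
  rintro _ ⟨y, rfl⟩
  exact ⟨B.elt q * y, by rw [lmul_apply, lmul_apply, ← mul_assoc, B.elt_nil_mul]⟩

theorem elt_mem_pathModule {b c : V} (q : Path b c) : B.elt q ∈ B.pathModule q :=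
  ⟨1, mul_one _⟩

theorem apply_eq_mul_of_pathModule_nil {b : V}
    (ψ : B.pathModule (Path.nil : Path b b) →ₗ[Aᵐᵒᵖ] A)
    (x : B.pathModule (Path.nil : Path b b)) :
    ψ x = ψ ⟨B.elt (Path.nil : Path b b), elt_mem_pathModule _⟩ * x := by
  have h := ψ.map_smul (MulOpposite.op (x : A)) ⟨B.elt (Path.nil : Path b b), elt_mem_pathModule _⟩
  rw [MulOpposite.smul_eq_mul_unop, MulOpposite.unop_op] at h
  rw [← h]
  exact congrArg ψ (Subtype.ext (nil_mul_of_mem x.2).symm)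

theorem source_eq_of_mem {b c d : V} {x : A} (hx : x ∈ B.pathModule (Path.nil : Path b b))
    {p : Path c d} (h : B.coef x ⟨c, d, p⟩ ≠ 0) : b = c := by
  by_contra hbc
  rw [← nil_mul_of_mem hx, B.coef_nil_mul_of_ne _ _ hbc] at h
  exact h rfl

/-- The kernel of left multiplication by `p` at the end of `p` is `qA`. -/
theorem mem_pathModule_of_mul_eq_zero {a b c : V} {p : Path a b} {q : Path b c}
    (hq : ∀ (d : V) (w : Path b d), B.elt w ≠ 0 → B.elt (p.comp w) = 0 →
      ∃ r : Path c d, w = q.comp r)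
    {x : A} (hx : x ∈ B.pathModule (Path.nil : Path b b)) (hpx : B.elt p * x = 0) :
    x ∈ B.pathModule q := by
  have : x ∈ LinearMap.range (LinearMap.mulLeft k (B.elt q)) := by
    refine B.mem_of_coef _ fun {c' d} w hw => ?_
    obtain rfl := source_eq_of_mem hx hw
    obtain ⟨r, rfl⟩ := hq d w (B.elt_ne_zero hw) (B.elt_comp_eq_zero_of_elt_mul_eq_zero hpx hw)
    exact ⟨B.elt r, B.elt_mul_elt _ _⟩
  obtain ⟨y, hy⟩ := this
  exact ⟨y, hy⟩

theorem exact_inclusion_cover {a b c : V} {p : Path a b} {q : Path b c}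
    (hpq : B.elt (p.comp q) = 0)
    (hq : ∀ (d : V) (w : Path b d), B.elt w ≠ 0 → B.elt (p.comp w) = 0 →
      ∃ r : Path c d, w = q.comp r) :
    Function.Exact (Submodule.inclusion (pathModule_le (B := B) q)) (B.cover p) := by
  intro x
  constructor
  · intro h
    exact ⟨⟨x, mem_pathModule_of_mul_eq_zero hq x.2 (congrArg Subtype.val h)⟩, rfl⟩
  · rintro ⟨⟨_, y, rfl⟩, rfl⟩
    refine Subtype.ext ?_
    change B.elt p * (B.elt q * y) = 0
    rw [← mul_assoc, B.elt_mul_elt, hpq, zero_mul]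

/-- A splitting of `A → qA` would be left multiplication by some `a`, giving `q = qaq`. Then the
trivial path occurs in `aq`, although all paths occurring there end with the nontrivial `q`. -/
theorem not_projective_of_formsExtend {b c : V} {q : Path b c} (hq : 0 < q.length)
    (hq0 : B.elt q ≠ 0) (h : B.FormsExtend q) : ¬ Module.Projective Aᵐᵒᵖ (B.pathModule q) := by
  intro hproj
  obtain ⟨s, hs⟩ := Module.projective_lifting_property (lmul (B.elt q)).rangeRestrict LinearMap.id
    (LinearMap.surjective_rangeRestrict _)
  obtain ⟨a, ha⟩ := h s
  have h1 : B.elt q * (a * B.elt q) = B.elt q := by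
    have := congrArg Subtype.val (LinearMap.congr_fun hs ⟨B.elt q, elt_mem_pathModule q⟩)
    rw [LinearMap.comp_apply, ha] at this
    exact this
  have h2 := B.coef_elt_mul (a * B.elt q) q Path.nil (by rwa [Path.comp_nil])
  rw [Path.comp_nil, h1, B.coef_elt_self q hq0] at h2
  have h3 : B.coef (a * B.elt q) ⟨c, c, Path.nil⟩ ≠ 0 := by
    rw [← h2]
    exact one_ne_zero
  obtain ⟨w, e, -⟩ := B.exists_eq_comp_of_coef_mul_elt _ _ _ h3
  have := congrArg (fun p : AnyPath V => p.2.2.length) e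
  simp only [Path.length_comp, Path.length_nil] at this
  omega

/-- A form-extending left factor is determined by its right annihilator. -/
theorem exists_eq_comp_of_formsExtend {a b c : V} {p : Path a b} {q : Path b c}
    (hp : B.FormsExtend p)
    (hq : ∀ (d : V) (w : Path b d), B.elt w ≠ 0 → B.elt (p.comp w) = 0 →
      ∃ r : Path c d, w = q.comp r)
    {d : V} (p' : Path d b) (hp' : B.elt p' ≠ 0) (hpq : B.elt (p'.comp q) = 0) :
    ∃ r : Path d a, p' = r.comp p := by
  have hker : LinearMap.ker (lmul (B.elt p)) ≤ LinearMap.ker (lmul (B.elt p')) := by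
    intro y hy
    rw [LinearMap.mem_ker, lmul_apply] at hy ⊢
    obtain ⟨z, hz⟩ := mem_pathModule_of_mul_eq_zero hq
      (x := B.elt (Path.nil : Path b b) * y) ⟨y, rfl⟩
      (by rw [← mul_assoc, B.elt_mul_nil, hy])
    rw [← B.elt_mul_nil p', mul_assoc, ← hz, lmul_apply, ← mul_assoc, B.elt_mul_elt, hpq, zero_mul]
  -- The annihilator of `p` is contained in that of `p'`, so `py ↦ p'y` is a well-defined form on
  -- `pA`. It is left multiplication by `a'`, whence `p' = a'p`.
  obtain ⟨a', ha⟩ := hp ((LinearMap.ker (lmul (B.elt p))).liftQ (lmul (B.elt p')) hker ∘ₗ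
    (lmul (B.elt p)).quotKerEquivRange.symm.toLinearMap)
  have h1 : B.elt p' = a' * B.elt p := by
    rw [← ha ⟨B.elt p, elt_mem_pathModule p⟩, LinearMap.comp_apply, LinearEquiv.coe_coe]
    have : (⟨B.elt p, elt_mem_pathModule p⟩ : B.pathModule p) =
        (lmul (B.elt p)).quotKerEquivRange (Submodule.Quotient.mk 1) :=
      Subtype.ext (by rw [LinearMap.quotKerEquivRange_apply_mk, lmul_apply, mul_one])
    rw [this, LinearEquiv.symm_apply_apply, Submodule.liftQ_apply, lmul_apply, mul_one]
  have h2 : B.coef (a' * B.elt p) ⟨d, b, p'⟩ ≠ 0 := by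
    rw [← h1, B.coef_elt_self p' hp']
    exact one_ne_zero
  obtain ⟨w, e, -⟩ := B.exists_eq_comp_of_coef_mul_elt _ _ _ h2
  obtain ⟨-, e⟩ := Sigma.mk.inj_iff.mp e
  obtain ⟨-, e⟩ := Sigma.mk.inj_iff.mp (eq_of_heq e)
  exact ⟨w, eq_of_heq e⟩

/-- Once a path is at least as long as `q`, prolonging it on the right no longer changes whether it
starts with `q`. Thus the projection is right linear on such paths. -/
theorem proj_startsWith_mul {b c : V} (q : Path b c) {x : A}
    (hx : ∀ {d e : V} (w : Path d e), B.coef x ⟨d, e, w⟩ ≠ 0 → d = b ∧ q.length ≤ w.length)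
    (a : A) : B.proj (StartsWith q) (x * a) = B.proj (StartsWith q) x * a := by
  suffices H : x ∈ LinearMap.ker ((B.proj (StartsWith q)) ∘ₗ LinearMap.mulRight k a -
      LinearMap.mulRight k a ∘ₗ B.proj (StartsWith q)) from sub_eq_zero.mp H
  refine B.mem_of_coef _ fun {d e} w hw => ?_
  obtain ⟨rfl, hl⟩ := hx w hw
  refine sub_eq_zero.mpr ?_
  change B.proj (StartsWith q) (B.elt w * a) = B.proj (StartsWith q) (B.elt w) * a
  induction a using B.induction with
  | zero => simp
  | add a a' h h' => simp [mul_add, h, h']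
  | smul r a h => simp [h]
  | @path e' f r _ =>
    by_cases he : e = e'
    · subst he
      rw [B.elt_mul_elt, B.proj_elt, B.proj_elt]
      have hiff : StartsWith q ⟨d, f, w.comp r⟩ ↔ StartsWith q ⟨d, e, w⟩ := by
        constructor
        · rintro ⟨f', s, h⟩
          obtain ⟨-, h⟩ := Sigma.mk.inj_iff.mp h
          obtain ⟨rfl, h⟩ := Sigma.mk.inj_iff.mp (eq_of_heq h)
          obtain ⟨s', rfl⟩ := exists_eq_comp_of_comp_eq_comp (eq_of_heq h) hl
          exact ⟨e, s', rfl⟩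
        · rintro ⟨f', s, h⟩
          obtain ⟨-, h⟩ := Sigma.mk.inj_iff.mp h
          obtain ⟨rfl, h⟩ := Sigma.mk.inj_iff.mp (eq_of_heq h)
          obtain rfl := eq_of_heq h
          exact ⟨f, s.comp r, by rw [Path.comp_assoc]⟩
      by_cases h : StartsWith q ⟨d, e, w⟩
      · rw [if_pos h, if_pos (hiff.mpr h), B.elt_mul_elt]
      · rw [if_neg h, if_neg (mt hiff.mp h), zero_mul]
    · rw [B.elt_mul_elt_of_ne _ _ he, B.proj_elt]
      split_ifs
      · simp [B.elt_mul_elt_of_ne _ _ he]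
      · simp

/-- If all higher extension groups of a non-projective module `pA` by the algebra vanish, then its
first syzygy is generated by a path. -/
theorem exists_syzygy_path {a b : V} {p : Path a b} (hp : B.elt p ≠ 0)
    (hE : ExtVanish Aᵐᵒᵖ A (B.pathModule p)) (hP : ¬ Module.Projective Aᵐᵒᵖ (B.pathModule p)) :
    ∃ (c : V) (q : Path b c), 0 < q.length ∧ B.elt q ≠ 0 ∧ B.elt (p.comp q) = 0 ∧
      (∀ (d : V) (w : Path b d), B.elt w ≠ 0 → B.elt (p.comp w) = 0 →
        ∃ r : Path c d, w = q.comp r) ∧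
      ExtVanish Aᵐᵒᵖ A (B.pathModule q) ∧ B.FormsExtend q := by
  classical
  have hex : ∃ n, ∃ (c : V) (w : Path b c), w.length = n ∧ B.elt w ≠ 0 ∧
      B.elt (p.comp w) = 0 := by
    by_contra! hall
    refine hP (Module.Projective.of_equiv (LinearEquiv.ofBijective (B.cover p)
      ⟨LinearMap.ker_eq_bot.mp ?_, surjective_cover p⟩))
    rw [eq_bot_iff]
    intro x hx
    refine Subtype.ext (B.eq_zero_of_coef fun {c d} w => ?_)
    by_contra hw
    obtain rfl := source_eq_of_mem x.2 hw
    exact hall _ d w rfl (B.elt_ne_zero hw)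
      (B.elt_comp_eq_zero_of_elt_mul_eq_zero (congrArg Subtype.val hx) hw)
  -- A shortest nonzero path killed by `p`; minimal length makes the projection onto paths starting
  -- with `q` linear on the kernel of the cover.
  obtain ⟨c, q, hql, hq0, hpq⟩ := Nat.find_spec hex
  have hmin : ∀ (d : V) (w : Path b d), B.elt w ≠ 0 → B.elt (p.comp w) = 0 →
      q.length ≤ w.length := fun d w h h' => by
    rw [hql]
    exact Nat.find_min' hex ⟨d, w, rfl, h, h'⟩
  have hsupp : ∀ x ∈ LinearMap.ker (B.cover p), ∀ {d e : V} (w : Path d e),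
      B.coef (x : A) ⟨d, e, w⟩ ≠ 0 → d = b ∧ q.length ≤ w.length := by
    intro x hx d e w hw
    obtain rfl := source_eq_of_mem x.2 hw
    exact ⟨rfl, hmin _ w (B.elt_ne_zero hw)
      (B.elt_comp_eq_zero_of_elt_mul_eq_zero (congrArg Subtype.val hx) hw)⟩
  let φ : LinearMap.ker (B.cover p) →ₗ[Aᵐᵒᵖ] A :=
    { toFun := fun x => B.proj (StartsWith q) (x : A)
      map_add' := fun x y => map_add (B.proj (StartsWith q)) _ _
      map_smul' := fun a x => proj_startsWith_mul q (fun w => hsupp x x.2 w) a.unop }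
  obtain ⟨ψ, hψ⟩ := hE.exists_extend_ker (surjective_cover p) φ
  set t := ψ ⟨B.elt (Path.nil : Path b b), elt_mem_pathModule _⟩ with ht
  have hmul : ∀ {d : V} (w : Path b d), B.elt (p.comp w) = 0 →
      t * B.elt w = B.proj (StartsWith q) (B.elt w) := by
    intro d w hw
    have hw' : (⟨B.elt w, pathModule_le w (elt_mem_pathModule w)⟩ :
        B.pathModule (Path.nil : Path b b)) ∈ LinearMap.ker (B.cover p) :=
      Subtype.ext ((B.elt_mul_elt p w).trans hw)
    have h1 := hψ ⟨_, hw'⟩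
    rw [apply_eq_mul_of_pathModule_nil] at h1
    exact h1
  have hcoef : ∀ {d : V} (w : Path b d), B.elt w ≠ 0 → B.coef (t * B.elt w) ⟨b, d, w⟩ =
      B.coef t ⟨b, b, Path.nil⟩ := by
    intro d w hw
    have := B.coef_mul_elt t Path.nil w (by rwa [Path.nil_comp])
    rwa [Path.nil_comp] at this
  -- The extended form is left multiplication by `t`. Its coefficient at the trivial path is the
  -- coefficient of `w` in `tw` for every nonzero `w`; evaluating at `q` gives one, so no path
  -- killed by `p` can be projected to zero.
  have ht1 : B.coef t ⟨b, b, Path.nil⟩ = 1 := by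
    rw [← hcoef q hq0, hmul q hpq, B.proj_elt, if_pos ⟨c, Path.nil, rfl⟩, B.coef_elt_self q hq0]
  have hq : ∀ (d : V) (w : Path b d), B.elt w ≠ 0 → B.elt (p.comp w) = 0 →
      ∃ r : Path c d, w = q.comp r := by
    intro d w hw hpw
    by_contra hno
    have hno' : ¬ StartsWith q ⟨b, d, w⟩ := by
      rintro ⟨d', r, h⟩
      obtain ⟨-, h⟩ := Sigma.mk.inj_iff.mp h
      obtain ⟨rfl, h⟩ := Sigma.mk.inj_iff.mp (eq_of_heq h)
      exact hno ⟨r, eq_of_heq h⟩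
    have := hcoef w hw
    rw [hmul w hpw, B.proj_elt, if_neg hno', ht1] at this
    simp at this
  have hexact := exact_inclusion_cover hpq hq
  refine ⟨c, q, ?_, hq0, hpq, hq,
    hE.syzygy (Submodule.inclusion_injective _) hexact (surjective_cover p), fun χ => ?_⟩
  · rw [Nat.pos_iff_ne_zero]
    intro h0
    cases q with
    | nil => exact hp hpq
    | cons q α => simp at h0
  · obtain ⟨ω, rfl⟩ := hE.exists_extend (Submodule.inclusion_injective _) hexact
      (surjective_cover p) χ
    exact ⟨_, fun x => apply_eq_mul_of_pathModule_nil ω _⟩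

/-- A non-projective module `pA` whose higher extension groups by the algebra vanish yields a
closed walk of perfect pairs. -/
theorem IsString.exists_perfect_cycle (hB : B.IsString) {a b : V} {p : Path a b}
    (hp : B.elt p ≠ 0) (hE : ExtVanish Aᵐᵒᵖ A (B.pathModule p))
    (hP : ¬ Module.Projective Aᵐᵒᵖ (B.pathModule p)) :
    ∃ (n : ℕ) (s : Fin (n + 1) → AnyPath V), 1 ≤ n ∧ s (Fin.last n) = s 0 ∧
      ∀ i : Fin n, B.PerfectRel (s i.castSucc) (s i.succ) := by
  let T := {P : AnyPath V // B.elt P.2.2 ≠ 0 ∧ 0 < P.2.2.length ∧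
    ExtVanish Aᵐᵒᵖ A (B.pathModule P.2.2) ∧ B.FormsExtend P.2.2}
  have : Finite T := Set.Finite.subset hB.finite_paths fun P hP => hP.1
  -- The walk starts at the first syzygy and not at `p`, because forms are known to extend only from
  -- a syzygy.
  obtain ⟨c₀, q₀, hl₀, hq₀, -, -, hE₀, hF₀⟩ := exists_syzygy_path hp hE hP
  have step : ∀ P : T, ∃ Q : T, B.PerfectRel P Q := by
    rintro ⟨⟨a, b, p⟩, hp, hl, hE, hF⟩
    obtain ⟨c, q, hql, hq, hpq, hann, hEq, hFq⟩ :=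
      exists_syzygy_path hp hE (not_projective_of_formsExtend hl hp hF)
    refine ⟨⟨⟨b, c, q⟩, hq, hql, hEq, hFq⟩, a, b, c, p, q, rfl, rfl, hl, hql, hp, hq, hpq,
      fun d w _ => hann d w, fun d p' _ hp' hpq' => ?_⟩
    exact exists_eq_comp_of_formsExtend hF hann p' hp' hpq'
  choose nxt hnxt using step
  let s : ℕ → T := fun n => nxt^[n] ⟨⟨_, _, q₀⟩, hq₀, hl₀, hE₀, hF₀⟩
  have hs (n : ℕ) : B.PerfectRel (s n) (s (n + 1)) := by
    change B.PerfectRel _ (nxt^[n + 1] _).1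
    rw [Function.iterate_succ_apply']
    exact hnxt _
  obtain ⟨i, j, hij, h⟩ : ∃ i j, i < j ∧ s i = s j := by
    obtain ⟨i, j, hne, h⟩ := Finite.exists_ne_map_eq_of_infinite s
    rcases lt_or_gt_of_ne hne with h' | h'
    · exact ⟨i, j, h', h⟩
    · exact ⟨j, i, h', h.symm⟩
  refine ⟨j - i, fun m => (s (i + m)).1, by omega, ?_, fun m => hs (i + m)⟩
  simp only [Fin.val_last, Fin.val_zero, add_zero]
  rw [Nat.add_sub_cancel' hij.le, h]

end PathPresentation

/-! ### From a cycle to a totally acyclic complex -/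

/-- A closed walk can be unrolled, backwards, to a bi-infinite one. -/
theorem exists_walk_of_cycle {X : Type*} {R : X → X → Prop} {n : ℕ}
    {s : Fin (n + 1) → X} (hn : 1 ≤ n) (hs : s (Fin.last n) = s 0)
    (h : ∀ i : Fin n, R (s i.castSucc) (s i.succ)) :
    ∃ τ : ℤ → X, ∀ i, R (τ (i + 1)) (τ i) := by
  have hn' : (0 : ℤ) < n := by exact_mod_cast hn
  have hlt (i : ℤ) : (i % n).toNat < n := by
    have := Int.emod_nonneg i hn'.ne'
    have := Int.emod_lt_of_pos i hn'
    omega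
  let σ : ℤ → X := fun i => s (Fin.castSucc ⟨(i % n).toNat, hlt i⟩)
  have hσ (i : ℤ) : R (σ i) (σ (i + 1)) := by
    have h1 : σ (i + 1) = s (Fin.succ ⟨(i % n).toNat, hlt i⟩) := by
      have h0 := Int.emod_nonneg i hn'.ne'
      have h2 := Int.emod_lt_of_pos i hn'
      have h3 : (i + 1) % n = (i % n + 1) % n := by rw [Int.emod_add_emod]
      by_cases h4 : i % n + 1 = n
      · rw [h4, Int.emod_self] at h3
        have e1 : Fin.succ ⟨(i % n).toNat, hlt i⟩ = Fin.last n := by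
          ext
          simp only [Fin.val_succ, Fin.val_last]
          omega
        rw [e1, hs]
        refine congrArg s (Fin.ext ?_)
        simp [h3]
      · rw [Int.emod_eq_of_lt (a := i % n + 1) (b := n) (by omega) (by omega)] at h3
        refine congrArg s (Fin.ext ?_)
        simp only [Fin.val_succ, Fin.val_castSucc, h3]
        omega
    rw [h1]
    exact h _
  -- The walk is reversed because differentials raise the degree while acting on the left: the later
  -- differential is the left factor of a perfect pair.
  refine ⟨fun i => σ (-i), fun i => ?_⟩
  have := hσ (-(i + 1))
  rwa [show -(i + 1) + 1 = -i by ring] at this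

section Resolution

variable {A : Type u'} [Ring A]

/-- A totally acyclic complex of projective modules `e i A` with differentials given by left
multiplication. -/
theorem isGorensteinProjective_range_lmul (e x : ℤ → A) (he : ∀ i, e i * e i = e i)
    (hex : ∀ i, e (i + 1) * x i = x i) (hxe : ∀ i, x i * e i = x i)
    (hxx : ∀ i, x (i + 1) * x i = 0)
    (hr : ∀ i y, e (i + 1) * y = y → x (i + 1) * y = 0 → ∃ z, y = x i * z)
    (hl : ∀ i b, b * e (i + 1) = b → b * x i = 0 → ∃ c, b = c * x (i + 1)) :
    IsGorensteinProjective A (LinearMap.range (lmul (x (-1)))) := by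
  have hmem (i : ℤ) (y : A) : y ∈ LinearMap.range (lmul (e i)) ↔ e i * y = y := by
    constructor
    · rintro ⟨z, rfl⟩
      rw [lmul_apply, ← mul_assoc, he]
    · intro h
      exact ⟨y, h⟩
  let P : ℤ → Type u' := fun i => LinearMap.range (lmul (e i))
  let d : ∀ i, LinearMap.range (lmul (e i)) →ₗ[Aᵐᵒᵖ] LinearMap.range (lmul (e (i + 1))) := fun i =>
    ((lmul (x i)).comp (LinearMap.range (lmul (e i))).subtype).codRestrict _ fun y => by
      rw [hmem]
      change e (i + 1) * (x i * y) = x i * y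
      rw [← mul_assoc, hex]
  have hd (i) (y) : (d i y : A) = x i * y := rfl
  have : Module.Finite Aᵐᵒᵖ A := Module.Finite.equiv (opLinearEquiv A)
  refine ⟨P, fun _ => inferInstanceAs (AddCommGroup (LinearMap.range _)),
    fun _ => inferInstanceAs (Module Aᵐᵒᵖ (LinearMap.range _)), d,
    fun i => inferInstanceAs (Module.Finite Aᵐᵒᵖ (LinearMap.range _)),
    fun i => projective_range_lmul_of_isIdempotent (he i), fun i y => ?_, fun i f => ?_, ⟨?_⟩⟩
  · constructor
    · intro hy
      obtain ⟨z, hz⟩ := hr i y ((hmem _ _).mp y.2) (congrArg Subtype.val hy)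
      refine ⟨⟨e i * z, z, rfl⟩, Subtype.ext ?_⟩
      change x i * (e i * z) = y
      rw [← mul_assoc, hxe, hz]
    · rintro ⟨z, rfl⟩
      refine Subtype.ext ?_
      change x (i + 1) * (x i * z) = 0
      rw [← mul_assoc, hxx, zero_mul]
  · have hf (y : LinearMap.range (lmul (e (i + 1)))) :
        f y = f ⟨e (i + 1), (hmem _ _).mpr (he _)⟩ * y := by
      have h := f.map_smul (MulOpposite.op (y : A)) ⟨e (i + 1), (hmem _ _).mpr (he _)⟩
      rw [MulOpposite.smul_eq_mul_unop, MulOpposite.unop_op] at h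
      rw [← h]
      exact congrArg f (Subtype.ext ((hmem _ _).mp y.2).symm)
    constructor
    · intro h
      -- A form on `e A` is left multiplication by its value at `e`. The cocycle condition says that
      -- this value annihilates `x i` from the left, so it factors through `x (i + 1)`.
      obtain ⟨c, hc⟩ := hl i (f ⟨e (i + 1), (hmem _ _).mpr (he _)⟩)
        (hf ⟨e (i + 1), (hmem _ _).mpr (he _)⟩).symm (by
        rw [← hf ⟨x i, (hmem _ _).mpr (hex i)⟩]
        have h1 := LinearMap.congr_fun h ⟨e i, (hmem _ _).mpr (he _)⟩
        rw [← LinearMap.zero_apply (σ₁₂ := RingHom.id Aᵐᵒᵖ)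
          (⟨e i, (hmem _ _).mpr (he _)⟩ : LinearMap.range (lmul (e i))), ← h1]
        exact congrArg f (Subtype.ext (hxe i).symm))
      refine ⟨(lmul c).comp (LinearMap.range (lmul (e (i + 1 + 1)))).subtype,
        LinearMap.ext fun y => ?_⟩
      rw [hf y, hc]
      change c * (x (i + 1) * y) = c * x (i + 1) * y
      rw [mul_assoc]
    · rintro ⟨g, rfl⟩
      refine LinearMap.ext fun y => ?_
      change g (d (i + 1) (d i y)) = 0
      rw [show d (i + 1) (d i y) = 0 from Subtype.ext ?_, map_zero]
      change x (i + 1) * (x i * y) = 0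
      rw [← mul_assoc, hxx, zero_mul]
  · let E := LinearMap.range (lmul (e (-1 + 1)))
    have hrange : (LinearMap.range (d (-1))).map E.subtype = LinearMap.range (lmul (x (-1))) := by
      ext y
      constructor
      · rintro ⟨_, ⟨z, rfl⟩, rfl⟩
        exact ⟨z, rfl⟩
      · rintro ⟨z, rfl⟩
        refine ⟨_, ⟨⟨e (-1) * z, z, rfl⟩, rfl⟩, ?_⟩
        change x (-1) * (e (-1) * z) = x (-1) * z
        rw [← mul_assoc, hxe]
    exact LinearEquiv.ofEq _ _ hrange.symm ≪≫ₗ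
      (Submodule.equivMapOfInjective E.subtype Subtype.val_injective _).symm

end Resolution

/-! ### Gorenstein-projective modules from perfect pairs -/

namespace PathPresentation

variable {k : Type u} {V : Type v} {A : Type u'} [Field k] [Quiver.{w} V] [Fintype V]
  [Ring A] [Algebra k A] {B : PathPresentation k V A}

theorem exists_eq_mul_of_mul_elt_eq_zero {b c : V} {q : Path b c} {a : V} {p : Path a b}
    (hq0 : B.elt q ≠ 0)
    (hp : ∀ (d : V) (w : Path d b), 0 < w.length → B.elt w ≠ 0 → B.elt (w.comp q) = 0 →
      ∃ r : Path d a, w = r.comp p)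
    {x : A} (hx : x * B.elt (Path.nil : Path b b) = x) (hxq : x * B.elt q = 0) :
    ∃ y, x = y * B.elt p := by
  have : x ∈ LinearMap.range (LinearMap.mulRight k (B.elt p)) := by
    refine B.mem_of_coef _ fun {d c'} w hw => ?_
    obtain rfl : b = c' := by
      by_contra hbc
      rw [← hx, B.coef_mul_nil_of_ne _ _ hbc] at hw
      exact hw rfl
    have h1 := B.elt_comp_eq_zero_of_mul_elt_eq_zero hxq hw
    obtain ⟨r, rfl⟩ := hp d w (by
      rw [Nat.pos_iff_ne_zero]
      intro h0
      cases w with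
      | nil => exact hq0 (by rwa [Path.nil_comp] at h1)
      | cons w α => simp at h0) (B.elt_ne_zero hw) h1
    exact ⟨B.elt r, B.elt_mul_elt _ _⟩
  obtain ⟨y, hy⟩ := this
  exact ⟨y, hy.symm⟩

namespace PerfectRel

variable {P Q : AnyPath V}

theorem nil_mul_elt (h : B.PerfectRel P Q) :
    B.elt (Path.nil : Path P.2.1 P.2.1) * B.elt Q.2.2 = B.elt Q.2.2 := by
  obtain ⟨a, b, c, p, q, rfl, rfl, h⟩ := h
  exact B.elt_nil_mul q

theorem elt_mul_elt (h : B.PerfectRel P Q) : B.elt P.2.2 * B.elt Q.2.2 = 0 := by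
  obtain ⟨a, b, c, p, q, rfl, rfl, h⟩ := h
  exact (B.elt_mul_elt p q).trans h.2.2.2.2.1

theorem length_pos (h : B.PerfectRel P Q) : 0 < Q.2.2.length := by
  obtain ⟨a, b, c, p, q, rfl, rfl, h⟩ := h
  exact h.2.1

theorem elt_ne_zero (h : B.PerfectRel P Q) : B.elt Q.2.2 ≠ 0 := by
  obtain ⟨a, b, c, p, q, rfl, rfl, h⟩ := h
  exact h.2.2.2.1

theorem exists_eq_elt_mul (h : B.PerfectRel P Q) {y : A}
    (hy : B.elt (Path.nil : Path P.2.1 P.2.1) * y = y) (hPy : B.elt P.2.2 * y = 0) :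
    ∃ z, y = B.elt Q.2.2 * z := by
  obtain ⟨a, b, c, p, q, rfl, rfl, h⟩ := h
  obtain ⟨z, hz⟩ := mem_pathModule_of_mul_eq_zero (q := q) (fun d w hw hpw =>
    h.2.2.2.2.2.1 d w (by
      rw [Nat.pos_iff_ne_zero]
      intro h0
      cases w with
      | nil => exact h.2.2.1 hpw
      | cons w α => simp at h0) hw hpw) ⟨y, hy⟩ hPy
  exact ⟨z, hz.symm⟩

theorem exists_eq_mul_elt (h : B.PerfectRel P Q) {y : A}
    (hy : y * B.elt (Path.nil : Path P.2.1 P.2.1) = y) (hPy : y * B.elt Q.2.2 = 0) :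
    ∃ z, y = z * B.elt P.2.2 := by
  obtain ⟨a, b, c, p, q, rfl, rfl, h⟩ := h
  exact exists_eq_mul_of_mul_elt_eq_zero h.2.2.2.1 h.2.2.2.2.2.2 hy hPy

end PerfectRel

/-- A bi-infinite walk of perfect pairs yields a non-projective Gorenstein-projective module. -/
theorem exists_gorensteinProjective_of_walk (τ : ℤ → AnyPath V)
    (hτ : ∀ i, B.PerfectRel (τ (i + 1)) (τ i)) :
    IsGorensteinProjective A (B.pathModule (τ (-1)).2.2) ∧
      ¬ Module.Projective Aᵐᵒᵖ (B.pathModule (τ (-1)).2.2) := by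
  let e : ℤ → A := fun i => B.elt (Path.nil : Path (τ i).2.1 (τ i).2.1)
  let x : ℤ → A := fun i => B.elt (τ i).2.2
  have he : ∀ i, e i * e i = e i := fun i => B.elt_nil_mul _
  have hxe : ∀ i, x i * e i = x i := fun i => B.elt_mul_nil _
  have hex : ∀ i, e (i + 1) * x i = x i := fun i => (hτ i).nil_mul_elt
  have hxx : ∀ i, x (i + 1) * x i = 0 := fun i => (hτ i).elt_mul_elt
  have hr : ∀ i y, e (i + 1) * y = y → x (i + 1) * y = 0 → ∃ z, y = x i * z := fun i y =>
    (hτ i).exists_eq_elt_mul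
  have hl : ∀ i b, b * e (i + 1) = b → b * x i = 0 → ∃ c, b = c * x (i + 1) := fun i b =>
    (hτ i).exists_eq_mul_elt
  refine ⟨isGorensteinProjective_range_lmul e x he hex hxe hxx hr hl, ?_⟩
  refine not_projective_of_formsExtend (hτ (-1)).length_pos (hτ (-1)).elt_ne_zero fun φ => ?_
  have hφ (y : B.pathModule (τ (-1)).2.2) (a : A) : φ (y <• a) = φ y * a := φ.map_smul _ _
  -- The generator `x (-1)` is killed on the right by `x (-2)`, hence so is its image under `φ`;
  -- left exactness in degree `-2` writes that image as a left multiple of `x (-1)`.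
  obtain ⟨c, hc⟩ := hl (-2) (φ ⟨x (-1), elt_mem_pathModule _⟩)
    ((hφ _ _).symm.trans (congrArg φ (Subtype.ext (hxe (-1)))))
    ((hφ _ _).symm.trans ((congrArg φ (Subtype.ext (hxx (-2)))).trans (map_zero φ)))
  refine ⟨c, ?_⟩
  rintro ⟨_, y, rfl⟩
  have h1 := hφ ⟨x (-1), elt_mem_pathModule _⟩ y
  rw [hc] at h1
  exact h1.trans (mul_assoc _ _ _)

/-! ### The two statements for a path presentation -/

theorem IsString.isCMFinite (hB : B.IsString) : IsCMFinite A := by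
  have := hB.finite_paths.to_subtype
  obtain ⟨n, ⟨f⟩⟩ := Finite.exists_equiv_fin {p : AnyPath V | B.elt p.2.2 ≠ 0}
  refine ⟨n, fun i => ModuleCat.of Aᵐᵒᵖ (B.pathModule (f.symm i).1.2.2), fun M _ _ hM hM' => ?_⟩
  obtain ⟨a, b, p, hp, ⟨e⟩⟩ := hB.exists_equiv_pathModule hM' hM.isReflexiveKernel
  refine ⟨f ⟨⟨a, b, p⟩, hp⟩, ⟨?_⟩⟩
  change M ≃ₗ[Aᵐᵒᵖ] B.pathModule (f.symm (f ⟨⟨a, b, p⟩, hp⟩)).1.2.2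
  rw [Equiv.symm_apply_apply]
  exact e

theorem IsString.isCMFree_iff (hB : B.IsString) :
    IsCMFree A ↔ ¬ ∃ (n : ℕ) (s : Fin (n + 1) → AnyPath V), 1 ≤ n ∧ s (Fin.last n) = s 0 ∧
      ∀ i : Fin n, B.PerfectRel (s i.castSucc) (s i.succ) := by
  constructor
  · rintro h ⟨n, s, hn, hs, hrel⟩
    obtain ⟨τ, hτ⟩ := exists_walk_of_cycle hn hs hrel
    obtain ⟨h1, h2⟩ := exists_gorensteinProjective_of_walk τ hτ
    exact h2 ((h _).mp h1).2
  · intro h M _ _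
    refine ⟨fun hM => ⟨hM.finite, ?_⟩, fun ⟨_, _⟩ => isGorensteinProjective_of_projective⟩
    by_contra hP
    have := hB.isArtinianRing
    have := hM.finite
    -- The summand need not be shown Gorenstein-projective: being a kernel and having vanishing
    -- `Ext` into `A` both pass to retracts.
    obtain ⟨N, r, hr, hN, hNP⟩ := exists_indecomposable_retract hP
    obtain ⟨a, b, p, hp, ⟨e⟩⟩ := hB.exists_equiv_pathModule hN
      (hM.isReflexiveKernel.of_retract N.subtype r hr)
    have hE : ExtVanish Aᵐᵒᵖ A (B.pathModule p) :=
      hM.extVanish.of_retract (N.subtype ∘ₗ e.symm.toLinearMap) (e.toLinearMap ∘ₗ r)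
        (LinearMap.ext fun y =>
          (congrArg e (LinearMap.congr_fun hr (e.symm y))).trans (e.apply_symm_apply y))
    exact h (hB.exists_perfect_cycle hp hE fun h' => hNP (Module.Projective.of_equiv e.symm))

end PathPresentation

/-! ### Monomial ideals and normal forms -/

namespace PathAlgebra

variable {k : Type u} {V : Type v} [Field k] [Quiver.{w} V] [Fintype V]

open Classical in
/-- The linear map that deletes from an element the paths lying in an ideal. -/
noncomputable def normalForm (I : Ideal (PathAlgebra k V)) :
    PathAlgebra k V →ₗ[k] (AnyPath V →₀ k) :=
  (Finsupp.linearCombination k fun p : AnyPath V =>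
    if single k p ∈ I then 0 else Finsupp.single p (1 : k) : (AnyPath V →₀ k) →ₗ[k] _)

open Classical in
theorem normalForm_single (I : Ideal (PathAlgebra k V)) (p : AnyPath V) :
    normalForm I (single k p) = if single k p ∈ I then 0 else Finsupp.single p 1 :=
  (Finsupp.linearCombination_single k 1 p).trans (one_smul k _)

theorem smul_mem_of_mem (I : Ideal (PathAlgebra k V)) (r : k) {x : PathAlgebra k V} (hx : x ∈ I) :
    r • x ∈ I := by
  rw [← one_mul x, ← smul_mul_assoc]
  exact I.mul_mem_left _ hx

theorem sub_linearCombination_normalForm_mem (I : Ideal (PathAlgebra k V)) (x : PathAlgebra k V) :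
    x - (Finsupp.linearCombination k (single k) : (AnyPath V →₀ k) →ₗ[k] PathAlgebra k V)
      (normalForm I x) ∈ I := by
  set L : (AnyPath V →₀ k) →ₗ[k] PathAlgebra k V := Finsupp.linearCombination k (single k) with hL
  induction x using induction with
  | @path a b p =>
    rw [ofPath, normalForm_single]
    split_ifs with h
    · simpa using h
    · simp [hL]
  | zero => simp
  | add x y hx hy =>
    rw [map_add, map_add, add_sub_add_comm]
    exact I.add_mem hx hy
  | smul r x hx =>
    rw [map_smul, map_smul, ← smul_sub]
    exact smul_mem_of_mem I r hx

theorem mem_of_normalForm_eq_zero {I : Ideal (PathAlgebra k V)} {x : PathAlgebra k V}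
    (hx : normalForm I x = 0) : x ∈ I := by
  have key := sub_linearCombination_normalForm_mem I x
  rwa [hx, map_zero, sub_zero] at key

/-- The span of the paths lying in `I` is itself a two-sided ideal, since a product of paths is a
path or zero. It contains the generators of `I`, and therefore all of `I`. -/
theorem span_paths_eq (I : Ideal (PathAlgebra k V)) [I.IsTwoSided] {S : Set (AnyPath V)}
    (hS : I = (TwoSidedIdeal.span (single k '' S)).asIdeal) {x : PathAlgebra k V} (hx : x ∈ I) :
    x ∈ Submodule.span k {y | ∃ p, single k p ∈ I ∧ y = single k p} := by
  set W := Submodule.span k {y | ∃ p, single k p ∈ I ∧ y = single k p} with hW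
  have hsingle : ∀ {p}, single k p ∈ I → single k p ∈ W := fun {p} hp =>
    Submodule.subset_span ⟨p, hp, rfl⟩
  have hleft : ∀ {x y}, y ∈ W → x * y ∈ W := by
    intro x y hy
    induction x using induction with
    | zero => simp
    | add x x' h h' => rw [add_mul]; exact W.add_mem h h'
    | smul r x h => rw [smul_mul_assoc]; exact W.smul_mem r h
    | @path a b p =>
    induction hy using Submodule.span_induction with
    | zero => simp
    | add y y' _ _ h h' => rw [mul_add]; exact W.add_mem h h'
    | smul r y _ h => rw [mul_smul_comm]; exact W.smul_mem r h
    | mem y hy =>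
      obtain ⟨⟨c, d, q⟩, hq, rfl⟩ := hy
      by_cases h : b = c
      · subst h
        have : ofPath k p * single k ⟨b, d, q⟩ = ofPath k (p.comp q) := ofPath_mul_ofPath p q
        rw [this]
        refine hsingle (p := ⟨a, d, p.comp q⟩) ?_
        change ofPath k (p.comp q) ∈ I
        rw [← this]
        exact I.mul_mem_left _ hq
      · have : ofPath k p * single k ⟨c, d, q⟩ = 0 := ofPath_mul_ofPath_of_ne p q h
        rw [this]
        exact W.zero_mem
  have hright : ∀ {x y}, x ∈ W → x * y ∈ W := by
    intro x y hx
    induction y using induction with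
    | zero => simp
    | add x x' h h' => rw [mul_add]; exact W.add_mem h h'
    | smul r x h => rw [mul_smul_comm]; exact W.smul_mem r h
    | @path c d q =>
    induction hx using Submodule.span_induction with
    | zero => simp
    | add y y' _ _ h h' => rw [add_mul]; exact W.add_mem h h'
    | smul r y _ h => rw [smul_mul_assoc]; exact W.smul_mem r h
    | mem y hy =>
      obtain ⟨⟨a, b, p⟩, hp, rfl⟩ := hy
      by_cases h : b = c
      · subst h
        have : single k ⟨a, b, p⟩ * ofPath k q = ofPath k (p.comp q) := ofPath_mul_ofPath p q
        rw [this]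
        refine hsingle (p := ⟨a, d, p.comp q⟩) ?_
        change ofPath k (p.comp q) ∈ I
        rw [← this]
        exact I.mul_mem_right _ hp
      · have : single k ⟨a, b, p⟩ * ofPath k q = 0 := ofPath_mul_ofPath_of_ne p q h
        rw [this]
        exact W.zero_mem
  let J : TwoSidedIdeal (PathAlgebra k V) := TwoSidedIdeal.mk' W W.zero_mem W.add_mem W.neg_mem
    hleft hright
  have hJ : TwoSidedIdeal.span (single k '' S) ≤ J := by
    rw [TwoSidedIdeal.span_le]
    rintro _ ⟨p, hp, rfl⟩
    rw [SetLike.mem_coe, TwoSidedIdeal.mem_mk']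
    refine hsingle ?_
    rw [hS, TwoSidedIdeal.mem_asIdeal]
    exact TwoSidedIdeal.subset_span ⟨p, hp, rfl⟩
  rw [hS, TwoSidedIdeal.mem_asIdeal] at hx
  have := hJ hx
  rwa [TwoSidedIdeal.mem_mk'] at this

theorem normalForm_eq_zero_iff (I : Ideal (PathAlgebra k V)) [I.IsTwoSided] {S : Set (AnyPath V)}
    (hS : I = (TwoSidedIdeal.span (single k '' S)).asIdeal) (x : PathAlgebra k V) :
    normalForm I x = 0 ↔ x ∈ I := by
  refine ⟨mem_of_normalForm_eq_zero, fun hx => ?_⟩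
  have hx' := span_paths_eq I hS hx
  clear hx
  induction hx' using Submodule.span_induction with
  | mem x h =>
    obtain ⟨p, hp, rfl⟩ := h
    rw [normalForm_single, if_pos hp]
  | zero => simp
  | add x y _ _ h h' => rw [map_add, h, h', add_zero]
  | smul r x _ h => rw [map_smul, h, smul_zero]

theorem ofPath_mem_arrowIdeal_pow {a b : V} (p : Path a b) :
    ofPath k p ∈ arrowIdeal k V ^ p.length := by
  induction p with
  | nil =>
    rw [Path.length_nil, Submodule.pow_zero, Ideal.one_eq_top]
    exact Submodule.mem_top
  | cons p α ih =>
    rw [Path.length_cons, Submodule.pow_succ,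
      show ofPath k (p.cons α) = ofPath k p * ofPath k α.toPath from
        (ofPath_mul_ofPath p α.toPath).symm]
    refine Ideal.mul_mem_mul ih ?_
    rw [arrowIdeal, TwoSidedIdeal.mem_asIdeal]
    exact TwoSidedIdeal.subset_span ⟨_, _, α, rfl⟩

end PathAlgebra

theorem finite_setOf_length_eq {V : Type v} [Quiver.{w} V] [Finite V]
    (h : ∀ x : V, Finite (Σ y : V, x ⟶ y)) (n : ℕ) :
    {P : AnyPath V | P.2.2.length = n}.Finite := by
  induction n with
  | zero =>
    refine (Set.finite_range fun v : V => (⟨v, v, Path.nil⟩ : AnyPath V)).subset ?_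
    rintro ⟨a, b, p⟩ hp
    cases p with
    | nil => exact ⟨a, rfl⟩
    | cons p α => simp at hp
  | succ n ih =>
    refine (ih.biUnion fun P _ => Set.finite_range fun α : Σ y, P.2.1 ⟶ y =>
      (⟨P.1, α.1, P.2.2.cons α.2⟩ : AnyPath V)).subset ?_
    rintro ⟨a, b, p⟩ hp
    cases p with
    | nil => simp at hp
    | @cons c _ p α =>
      exact Set.mem_biUnion (x := ⟨a, c, p⟩) (by simpa using hp) ⟨⟨b, α⟩, rfl⟩

/-! ### The path presentation of a string algebra -/

section Presentation

open PathAlgebra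

variable {k : Type u} {V : Type v} {A : Type u'} [Field k] [Quiver.{w} V] [Fintype V]
  [Ring A] [Algebra k A] (I : Ideal (PathAlgebra k V)) [I.IsTwoSided]
  (e : A ≃ₐ[k] PathAlgebra k V ⧸ I)

/-- The projection of the path algebra onto an algebra presented by it. -/
noncomputable def presentationMap : PathAlgebra k V →ₐ[k] A :=
  e.symm.toAlgHom.comp (Ideal.Quotient.mkₐ k I)

theorem presentationMap_surjective : Function.Surjective (presentationMap I e) :=
  e.symm.surjective.comp Ideal.Quotient.mk_surjective

theorem presentationMap_eq_zero_iff (x : PathAlgebra k V) : presentationMap I e x = 0 ↔ x ∈ I :=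
  (map_eq_zero_iff e.symm e.symm.injective).trans Ideal.Quotient.eq_zero_iff_mem

/-- The presentation of an algebra by a quiver with relations generated by paths. -/
noncomputable def pathPresentation {S : Set (AnyPath V)}
    (hS : I = (TwoSidedIdeal.span (single k '' S)).asIdeal) : PathPresentation k V A where
  elt p := presentationMap I e (ofPath k p)
  elt_mul_elt p q := by rw [← map_mul, ofPath_mul_ofPath]
  elt_mul_elt_of_ne p q h := by rw [← map_mul, ofPath_mul_ofPath_of_ne p q h, map_zero]
  coef := (LinearMap.ker (presentationMap I e).toLinearMap).liftQ (normalForm I) (fun x hx =>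
      (normalForm_eq_zero_iff I hS x).mpr ((presentationMap_eq_zero_iff I e x).mp hx)) ∘ₗ
    ((presentationMap I e).toLinearMap.quotKerEquivOfSurjective
      (presentationMap_surjective I e)).symm.toLinearMap
  coef_injective := by
    rw [LinearMap.coe_comp]
    refine Function.Injective.comp ?_ (LinearEquiv.injective _)
    rw [← LinearMap.ker_eq_bot]
    refine Submodule.ker_liftQ_eq_bot _ _ _ fun x hx => ?_
    exact (presentationMap_eq_zero_iff I e x).mpr ((normalForm_eq_zero_iff I hS x).mp hx)
  coef_elt {a b} p hp := by
    have h1 : ((presentationMap I e).toLinearMap.quotKerEquivOfSurjective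
        (presentationMap_surjective I e)).symm (presentationMap I e (ofPath k p)) =
        Submodule.Quotient.mk (ofPath k p) := by
      rw [LinearEquiv.symm_apply_eq]
      rfl
    rw [LinearMap.comp_apply, LinearEquiv.coe_coe, h1]
    exact (normalForm_single I _).trans
      (if_neg fun h => hp ((presentationMap_eq_zero_iff I e _).mpr h))
  span_elt := by
    have h := congrArg (Submodule.map (presentationMap I e).toLinearMap)
      (span_single (k := k) (V := V))
    rw [Submodule.map_span, Submodule.map_top, LinearMap.range_eq_top.mpr
      (presentationMap_surjective I e), ← Set.range_comp] at h
    exact h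

variable {S : Set (AnyPath V)} (hS : I = (TwoSidedIdeal.span (single k '' S)).asIdeal)

theorem pathPresentation_elt_eq_zero_iff {a b : V} (p : Path a b) :
    (pathPresentation I e hS).elt p = 0 ↔ ofPath k p ∈ I :=
  presentationMap_eq_zero_iff I e _

theorem IsStringQuiver.isString (hI : IsStringQuiver I) : (pathPresentation I e hS).IsString where
  unique_right α β β' h h' := hI.unique_right α β β'
    (mt (pathPresentation_elt_eq_zero_iff I e hS _).mpr h)
    (mt (pathPresentation_elt_eq_zero_iff I e hS _).mpr h')
  unique_left α β β' h h' := hI.unique_left α β β'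
    (mt (pathPresentation_elt_eq_zero_iff I e hS _).mpr h)
    (mt (pathPresentation_elt_eq_zero_iff I e hS _).mpr h')
  finite_paths := by
    obtain ⟨m, -, hm, -⟩ := hI.admissible
    have hfin : ∀ x : V, Finite (Σ y : V, x ⟶ y) := fun x =>
      ENat.card_lt_top.mp ((hI.card_out_le x).trans_lt (by exact ENat.natCast_lt_top 2))
    -- A path of length exactly `m` lies in the `m`-th power of the arrow ideal, hence in `I`; a
    -- longer one has a shorter prefix already in `I`. So nonzero paths have length below `m`, and
    -- finitely many arrows leave each vertex.
    have hmem : ∀ {a b : V} (p : Path a b), m ≤ p.length → ofPath k p ∈ I := by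
      intro a b p hp
      induction p with
      | nil =>
        have h := ofPath_mem_arrowIdeal_pow (k := k) (Path.nil : Path a a)
        obtain rfl : m = 0 := by simpa using hp
        exact hm h
      | cons p α ih =>
        rcases hp.lt_or_eq with h | h
        · rw [show ofPath k (p.cons α) = ofPath k p * ofPath k α.toPath from
            (ofPath_mul_ofPath p α.toPath).symm]
          exact I.mul_mem_right _ (ih (by simpa [Nat.lt_succ_iff] using h))
        · exact hm (h ▸ ofPath_mem_arrowIdeal_pow (p.cons α))
    refine ((Set.finite_lt_nat m).biUnion fun n _ => finite_setOf_length_eq hfin n).subset ?_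
    rintro ⟨a, b, p⟩ hp
    refine Set.mem_biUnion (x := p.length) ?_ rfl
    by_contra h
    exact hp ((pathPresentation_elt_eq_zero_iff I e hS p).mpr (hmem p (not_lt.mp h)))

theorem pathPresentation_isPerfect_iff {a b c : V} (p : Path a b) (q : Path b c) :
    (pathPresentation I e hS).IsPerfect p q ↔ IsPerfectPair I p q := by
  simp only [PathPresentation.IsPerfect, IsPerfectPair, ne_eq, pathPresentation_elt_eq_zero_iff]

end Presentation

end StringAlg

theorem corollary3p11 {k : Type u} [Field k] [IsAlgClosed k]
    {V : Type v} [Quiver.{w} V] [Fintype V]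
    (I : Ideal (StringAlg.PathAlgebra k V)) [I.IsTwoSided] (hI : StringAlg.IsStringQuiver I)
    {A : Type (max u v w)} [Ring A] [Algebra k A]
    (e : A ≃ₐ[k] StringAlg.PathAlgebra k V ⧸ I) :
    StringAlg.IsCMFinite A ∧
      (StringAlg.IsCMFree A ↔
        ¬ ∃ (n : ℕ) (s : Fin (n + 1) → StringAlg.AnyPath V),
          StringAlg.IsPerfectPathSequence I n s) := by
  obtain ⟨S, -, hS⟩ := hI.monomial
  have hB := hI.isString I e hS
  refine ⟨hB.isCMFinite, hB.isCMFree_iff.trans ?_⟩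
  simp only [StringAlg.IsPerfectPathSequence, StringAlg.PathPresentation.PerfectRel,
    StringAlg.pathPresentation_isPerfect_iff]
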